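/- **Definitions.** A *tropical curve* $C$ is a finite connected metric graph (multiple edges allowed) with only $1$-valent vertices (leaves) and $3$-valent vertices (inner vertices); edges incident to a leaf are called ends and have infinite length, all other edges are called inner edges and have finite positive length. Its genus is its first Betti number. Let $g\ge 0$, let $\alpha,\beta$ be partitions of the same positive integer, let $t=\ell(\alpha)+\ell(\beta)+2g-2$, where $\ell$ denotes the number of entries, and let $\underline z=\{z_1<\dots<z_t\}\subset\mathbb R$. A *tropical cover* of type $(g,\alpha,\beta,\underline z)$ is a continuous map $\varphi:C\to T\mathbb P^1=\mathbb R\cup\{\pm\infty\}$ from a tropical curve $C$ of genus $g$ such that: the set of images of the inner vertices is $\underline z$; leaves are mapped to $\pm\infty$; on each edge $e$ the map $\varphi$ is affine with a positive integer slope $\omega(e)$, the weight of $e$ (with respect to the orientation of $e$ along which $\varphi$ increases); at each inner vertex the sum of the weights of incoming edges equals the sum of the weights of outgoing edges; the weights of the ends going to $-\infty$ (resp. $+\infty$) are the entries of $\alpha$ (resp. $\beta$). An isomorphism of covers $\varphi_1,\varphi_2$ is an isometry $\Phi:C_1\to C_2$ with $\varphi_2\circ\Phi=\varphi_1$. A *symmetric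 cycle* is a pair of inner edges of equal weight with the same two endpoints; a *symmetric fork* is a pair of ends of equal weight at the same inner vertex; $\operatorname{Sym}(\varphi)$ is the set of symmetric cycles and forks. A tropical cover $\varphi$ is a *zigzag cover* if there is a non-empty connected subgraph $S\subset C$ containing no edge of a symmetric cycle or fork, such that $S$ contains an inner vertex, $S$ contains no edge of even weight, and every connected component of $C\setminus S$ is a *tail* of one of the following kinds (traversed towards $S$): (i) a symmetric fork of odd weight $o$, or an end of weight $2o$ with $o$ odd, followed by a chain of $k\ge 0$ symmetric cycles of weight $o$, in which consecutive pieces are joined to each other, and the last one to $S$, by edges of weight $2o$; (ii) a symmetric fork of even weight $e$ joined to $S$ by an edge of weight $2e$; (iii) an end of even weight attached to $S$. A *colouring* $\rho$ of $\varphi$ consists of a subset $I_\rho\subset\operatorname{Sym}(\varphi)$ and a choice of red or blue for each component of the subgraph formed by the edges of even weight outside $I_\rho$. Its multiplicity is $$\operatorname{mult}(\varphi,\rho)=2^{|E(I_\rho)|-|\operatorname{Sym}(\varphi)|}\prod_{c}\omega(c),$$ where $E(I_\rho)$ is the set of inner edges of even weight outside $I_\rho$ and $c$ runs over the symmetric cycles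 in $I_\rho$, $\omega(c)$ being the weight of either edge of $c$. Put $m(\varphi)=0$ if $\operatorname{mult}(\varphi,\rho)$ is odd for some colouring $\rho$, and $m(\varphi)=1$ otherwise. The *zigzag number* is $$Z_g(\alpha,\beta;\Lambda_{0,t})=\sum_{[\varphi]}2^{m(\varphi)},$$ the sum being over the isomorphism classes of zigzag covers of type $(g,\alpha,\beta,\underline z)$; it does not depend on the choice of $\underline z$. **Theorem.** Let $\lambda,\mu$ be partitions with $|\lambda|=|\mu|$. Suppose that the number of odd integers that appear an odd number of times in $\lambda$ plus the number of odd integers that appear an odd number of times in $\mu$ is at most $2$. For $g,m\ge 0$ put $$z_{\lambda,\mu}(g,m)=Z_g\big((\lambda,1^{2m}),(\mu,1^{2m});\Lambda_{0,t}\big),\qquad t=\ell(\lambda)+\ell(\mu)+2g-2+4m,$$ where $(\lambda,1^{2m})$ is obtained from $\lambda$ by adding $2m$ entries equal to $1$. Then $$\liminf_{g,m\to\infty}\frac{\ln z_{\lambda,\mu}(g,m)}{2g\ln m+4m\ln m}\ \ge\ 1,$$ where $g$ and $m$ tend to infinity independently of each other. -/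

import Mathlib

open Filter
open scoped ENNReal

noncomputable section

/-- A (finite) tropical curve: a connected metric graph, multiple edges being allowed, all of whose
vertices are 1-valent or 3-valent. Each edge carries a reference orientation from `src` to `tgt`.
The edges incident to a 1-valent vertex are exactly those of infinite length. -/
structure TropicalCurve where
  V : Type
  E : Type
  [fintypeV : Fintype V]
  [fintypeE : Fintype E]
  src : E → V
  tgt : E → V
  len : E → ℝ≥0∞
  connected : (SimpleGraph.fromRel fun u v : V => ∃ e : E, src e = u ∧ tgt e = v).Connected
  valence_eq : ∀ v : V,
    Nat.card {e : E // src e = v} + Nat.card {e : E // tgt e = v} = 1 ∨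
    Nat.card {e : E // src e = v} + Nat.card {e : E // tgt e = v} = 3
  len_pos : ∀ e, 0 < len e
  len_top : ∀ e, len e = ⊤ ↔
    (Nat.card {f : E // src f = src e} + Nat.card {f : E // tgt f = src e} = 1 ∨
     Nat.card {f : E // src f = tgt e} + Nat.card {f : E // tgt f = tgt e} = 1)

namespace TropicalCurve

attribute [instance] TropicalCurve.fintypeV TropicalCurve.fintypeE

variable (C : TropicalCurve)

/-- The number of edges at a vertex, loops being counted twice. -/
def valence (v : C.V) : ℕ :=
  Nat.card {e : C.E // C.src e = v} + Nat.card {e : C.E // C.tgt e = v}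

/-- The 1-valent vertices. -/
def IsLeaf (v : C.V) : Prop := C.valence v = 1

/-- The 3-valent vertices. -/
def IsInner (v : C.V) : Prop := C.valence v = 3

/-- The edges incident to a leaf; all other edges are inner edges. -/
def IsEnd (e : C.E) : Prop := C.IsLeaf (C.src e) ∨ C.IsLeaf (C.tgt e)

/-- `v` is an endpoint of `e`. -/
def Incident (e : C.E) (v : C.V) : Prop := C.src e = v ∨ C.tgt e = v

/-- `u` and `v` are the two endpoints of `e`, in some order. -/
def Joins (e : C.E) (u v : C.V) : Prop := s(C.src e, C.tgt e) = s(u, v)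

/-- The genus is the first Betti number. For a connected graph it is `g` iff `|E| - |V| + 1 = g`. -/
def HasGenus (g : ℕ) : Prop := Fintype.card C.E + 1 = Fintype.card C.V + g

/-- A (closed) subgraph: together with an edge it contains the endpoints of that edge. -/
structure Subgraph where
  verts : Set C.V
  edges : Set C.E
  src_mem : ∀ e ∈ edges, C.src e ∈ verts
  tgt_mem : ∀ e ∈ edges, C.tgt e ∈ verts

variable {C}

/-- A subgraph is connected (in particular non-empty). -/
def Subgraph.Connected (S : C.Subgraph) : Prop :=
  (SimpleGraph.fromRel fun u v : S.verts =>
    ∃ e ∈ S.edges, C.src e = u ∧ C.tgt e = v).Connected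

/-- The edges of the connected component of `C ∖ S` that contains the (open) edge `e₀ ∉ S`:
those reached from `e₀` by passing through vertices outside `S`.
(Every vertex outside `S` lies on an edge outside `S`, so a component is given by its edges.) -/
def Subgraph.componentOf (S : C.Subgraph) (e₀ : C.E) : Set C.E :=
  {f | Relation.ReflTransGen
    (fun a b : C.E => ∃ v, v ∉ S.verts ∧ C.Incident a v ∧ C.Incident b v) e₀ f}

end TropicalCurve

open scoped Classical in
/-- A tropical cover `φ : C → Tℙ¹ = ℝ ∪ {±∞}` of type `(g, lam, mu, z)` with simple branch points
`z` only. On each edge `φ` is affine linear with positive integer slope, so `φ` is given by its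
values `pos` at the vertices and its slopes `weight`; since `φ` is not constant on any edge, we
take as reference orientation of `C` the one along which `φ` increases. -/
structure TropicalCover (g : ℕ) (lam mu : Multiset ℕ) {t : ℕ} (z : Fin t → ℝ) where
  C : TropicalCurve
  genus : C.HasGenus g
  pos : C.V → EReal
  weight : C.E → ℕ
  weight_pos : ∀ e, 0 < weight e
  /-- the images of the inner vertices are the points `z` -/
  image_inner : pos '' {v | C.IsInner v} = Set.range fun i => ((z i : ℝ) : EReal)
  /-- the leaves are mapped to `±∞` -/
  image_leaf : ∀ v, C.IsLeaf v → pos v = ⊥ ∨ pos v = ⊤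
  /-- `φ` has slope `weight e` on the edge `e` -/
  slope : ∀ e, pos (C.tgt e) - pos (C.src e) = (weight e : EReal) * ((C.len e : ℝ≥0∞) : EReal)
  /-- the balancing condition -/
  balanced : ∀ v, C.IsInner v →
    ∑ e with C.tgt e = v, weight e = ∑ e with C.src e = v, weight e
  /-- the weights of the ends over `-∞` are the entries of `lam` -/
  left_ends : (Finset.univ.filter fun e => pos (C.src e) = ⊥).val.map weight = lam
  /-- the weights of the ends over `+∞` are the entries of `mu` -/
  right_ends : (Finset.univ.filter fun e => pos (C.tgt e) = ⊤).val.map weight = mu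

namespace TropicalCover

variable {g : ℕ} {lam mu : Multiset ℕ} {t : ℕ} {z : Fin t → ℝ}

/-- Two covers are isomorphic if there is an isometry `Φ : C₁ → C₂` with `φ₂ ∘ Φ = φ₁`. Such a `Φ`
respects vertices, edges and lengths, and, by compatibility with `φ₁` and `φ₂`, also the images of
the vertices, the orientations along which the maps increase, and the slopes. -/
def Isomorphic (φ ψ : TropicalCover g lam mu z) : Prop :=
  ∃ (a : φ.C.V ≃ ψ.C.V) (b : φ.C.E ≃ ψ.C.E),
    (∀ e, ψ.C.src (b e) = a (φ.C.src e)) ∧ (∀ e, ψ.C.tgt (b e) = a (φ.C.tgt e)) ∧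
    (∀ e, ψ.C.len (b e) = φ.C.len e) ∧ (∀ v, ψ.pos (a v) = φ.pos v) ∧
    (∀ e, ψ.weight (b e) = φ.weight e)

theorem Isomorphic.refl (φ : TropicalCover g lam mu z) : Isomorphic φ φ :=
  ⟨Equiv.refl _, Equiv.refl _, by simp⟩

theorem Isomorphic.symm {φ ψ : TropicalCover g lam mu z} (h : Isomorphic φ ψ) :
    Isomorphic ψ φ := by
  obtain ⟨a, b, h1, h2, h3, h4, h5⟩ := h
  refine ⟨a.symm, b.symm, fun e => ?_, fun e => ?_, fun e => ?_, fun v => ?_, fun e => ?_⟩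
  · rw [Equiv.eq_symm_apply, ← h1, Equiv.apply_symm_apply]
  · rw [Equiv.eq_symm_apply, ← h2, Equiv.apply_symm_apply]
  · rw [← h3, Equiv.apply_symm_apply]
  · rw [← h4, Equiv.apply_symm_apply]
  · rw [← h5, Equiv.apply_symm_apply]

theorem Isomorphic.trans {φ ψ χ : TropicalCover g lam mu z} (h : Isomorphic φ ψ)
    (h' : Isomorphic ψ χ) : Isomorphic φ χ := by
  obtain ⟨a, b, h1, h2, h3, h4, h5⟩ := h
  obtain ⟨a', b', k1, k2, k3, k4, k5⟩ := h'
  exact ⟨a.trans a', b.trans b', fun e => by simp [k1, h1], fun e => by simp [k2, h2],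
    fun e => by simp [k3, h3], fun v => by simp [k4, h4], fun e => by simp [k5, h5]⟩

variable (φ : TropicalCover g lam mu z)

/-- Symmetric cycles: pairs of inner edges of equal weight with the same two endpoints. -/
def symCycles : Set (Set φ.C.E) :=
  {P | ∃ e f, e ≠ f ∧ P = {e, f} ∧ φ.weight e = φ.weight f ∧ ¬ φ.C.IsEnd e ∧ ¬ φ.C.IsEnd f ∧
    φ.C.src e = φ.C.src f ∧ φ.C.tgt e = φ.C.tgt f}

/-- Symmetric forks: pairs of ends of equal weight adjacent to the same inner vertex. -/
def symForks : Set (Set φ.C.E) :=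
  {P | ∃ e f, e ≠ f ∧ P = {e, f} ∧ φ.weight e = φ.weight f ∧ φ.C.IsEnd e ∧ φ.C.IsEnd f ∧
    ∃ v, φ.C.IsInner v ∧ φ.C.Incident e v ∧ φ.C.Incident f v}

/-- `Sym φ`, the set of symmetric cycles and symmetric forks. -/
def symPairs : Set (Set φ.C.E) := φ.symCycles ∪ φ.symForks

/-- `φ.IsTail T e v`: the edges `T` form a tail whose last edge `e` leads to the vertex `v`. A tail
starts at its far side with an end of even weight or with a symmetric fork followed by an edge, and
continues with any number (possibly zero) of symmetric cycles of odd weight, each of them followed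
by an edge. By balancing, the edges between cycles and next to an odd fork all have weight `2o`, if
`o` is the weight of the cycles or fork, and a fork of even weight cannot be followed by a cycle. -/
inductive IsTail : Set φ.C.E → φ.C.E → φ.C.V → Prop
  | evenEnd (e : φ.C.E) (u v : φ.C.V) (hu : φ.C.IsLeaf u) (he : φ.C.Joins e u v)
      (hw : Even (φ.weight e)) : IsTail {e} e v
  | fork (f₁ f₂ e : φ.C.E) (u v : φ.C.V) (hf : {f₁, f₂} ∈ φ.symForks)
      (hu : φ.C.IsInner u) (h₁ : φ.C.Incident f₁ u) (h₂ : φ.C.Incident f₂ u)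
      (he : φ.C.Joins e u v) (hne₁ : e ≠ f₁) (hne₂ : e ≠ f₂) : IsTail {f₁, f₂, e} e v
  | cycle (T : Set φ.C.E) (e' : φ.C.E) (u : φ.C.V) (hT : IsTail T e' u)
      (c₁ c₂ e : φ.C.E) (u' v : φ.C.V) (hc : {c₁, c₂} ∈ φ.symCycles) (hodd : Odd (φ.weight c₁))
      (h₁ : φ.C.Joins c₁ u u') (h₂ : φ.C.Joins c₂ u u') (he : φ.C.Joins e u' v)
      (hne : e ∉ T ∪ {c₁, c₂}) : IsTail (T ∪ {c₁, c₂, e}) e v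

/-- Generalized zigzag covers, for covers with simple branch points only (so that there are no
contractible edges): there is a non-empty connected subgraph `S`, containing no edge of a symmetric
cycle or fork, such that `S` contains an inner vertex, `S` has no edge of even weight,
and all connected components of `C ∖ S` are tails attached to `S`. -/
def IsZigzag : Prop :=
  ∃ S : φ.C.Subgraph, S.Connected ∧ (∀ e ∈ S.edges, ∀ P ∈ φ.symPairs, e ∉ P) ∧
    (∃ v ∈ S.verts, φ.C.IsInner v) ∧ (∀ e ∈ S.edges, ¬ Even (φ.weight e)) ∧
    ∀ e₀, e₀ ∉ S.edges → ∃ e, ∃ v ∈ S.verts, φ.IsTail (S.componentOf e₀) e v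

/-- A colouring of a tropical cover: a subset `dotted` (usually denoted `I_ρ`) of the set of
symmetric cycles and forks, and a colour (red or blue) for each component of the subgraph of even
edges not in `dotted`, that is, a colour for each such edge, the same for edges sharing a vertex.
As there are no triple branch points, every colouring is effective. -/
structure Colouring where
  dotted : Set (Set φ.C.E)
  dotted_subset : dotted ⊆ φ.symPairs
  colour : {e : φ.C.E // Even (φ.weight e) ∧ ∀ P ∈ dotted, e ∉ P} → Bool
  colour_eq : ∀ e f v, φ.C.Incident e.1 v → φ.C.Incident f.1 v → colour e = colour f

variable {φ}

/-- The real multiplicity of a coloured tropical cover (without triple branch points):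
`2 ^ (|E(I_ρ)| - |Sym φ|)` times the product of the weights of the dotted symmetric cycles, where
`E(I_ρ)` is the set of inner edges of even weight outside `I_ρ`. The two edges of a symmetric
cycle have the same weight, which is the supremum of the weights over the cycle. -/
def Colouring.mult (ρ : φ.Colouring) : ℚ :=
  2 ^ Set.ncard {e : φ.C.E | ¬ φ.C.IsEnd e ∧ Even (φ.weight e) ∧ ∀ P ∈ ρ.dotted, e ∉ P} /
    2 ^ Set.ncard φ.symPairs *
  ∏ᶠ P ∈ φ.symCycles ∩ ρ.dotted, ((sSup (φ.weight '' P) : ℕ) : ℚ)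

variable (φ) in
/-- The multiplicity of some effective colouring of `φ` is an odd integer. -/
def HasOddMult : Prop := ∃ ρ : φ.Colouring, ∃ k : ℤ, Odd k ∧ ρ.mult = k

end TropicalCover

/-- Isomorphism of generalized zigzag covers of type `(g, lam, mu, z)`. -/
def zigzagSetoid (g : ℕ) (lam mu : Multiset ℕ) {t : ℕ} (z : Fin t → ℝ) :
    Setoid {φ : TropicalCover g lam mu z // φ.IsZigzag} where
  r φ ψ := φ.1.Isomorphic ψ.1
  iseqv := ⟨fun φ => .refl φ.1, .symm, .trans⟩

/-- The set of isomorphism classes of generalized zigzag covers of type `(g, lam, mu, z)`. -/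
abbrev ZigzagClass (g : ℕ) (lam mu : Multiset ℕ) {t : ℕ} (z : Fin t → ℝ) : Type 1 :=
  Quotient (zigzagSetoid g lam mu z)

open scoped Classical in
/-- The exponent `m(φ)` for `φ` in a class `c`: it is `0` if the multiplicity is odd, else `1`. -/
def ZigzagClass.exponent {g : ℕ} {lam mu : Multiset ℕ} {t : ℕ} {z : Fin t → ℝ}
    (c : ZigzagClass g lam mu z) : ℕ :=
  if ∃ φ : {φ : TropicalCover g lam mu z // φ.IsZigzag},
    Quotient.mk (zigzagSetoid g lam mu z) φ = c ∧ φ.1.HasOddMult then 0 else 1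

/-- The (generalized) zigzag number `Z_g(lam, mu; Λ_{0,t})`, computed with the simple branch points
`z`: the sum of `2 ^ m(φ)` over all isomorphism classes of zigzag covers of type
`(g, lam, mu, z)`. -/
def zigzagNumber (g : ℕ) (lam mu : Multiset ℕ) {t : ℕ} (z : Fin t → ℝ) : ℕ :=
  ∑ᶠ c : ZigzagClass g lam mu z, 2 ^ c.exponent

/-- The number of odd integers that appear an odd number of times in a partition. -/
def numOddOdd (lam : Multiset ℕ) : ℕ :=
  (lam.toFinset.filter fun k => Odd k ∧ Odd (lam.count k)).card

end

/-! Every isomorphism class contributes at least 1 to the zigzag number, so it suffices to exhibit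
many pairwise non-isomorphic zigzag covers on one fixed graph. The graph, recorded by `ZigzagData`,
is a path with odd weights and one tail at each inner vertex of the path; weights are signed, so the
path weight changes at each vertex by the signed weight of the tail. An ordering of the inner
vertices that is compatible with the edges yields a cover (`cover`), and this is a zigzag cover
(`cover_isZigzag`).

In a middle section the path weights alternate between -1 and 1, so that M left tails of signed
weight 2 alternate with M right forks of signed weight -2. Vertices in corresponding positions of
tails on the same side have the same level, hence may be permuted freely. With g = Mq + s and 0 ≤ s
< M, let s of the left tails carry q + 1 cycles of weight 1 and the others q. This gives at least
M!^(2q+4) · s!^2 orderings (`HasZigzag.factorial_le_zigzagNumber`). An isomorphism between two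
resulting covers induces an adjacency-preserving permutation of the inner vertices that respects
positions in the tails, and only the identity is of this kind (`rigid`), so the orderings give
distinct classes (`card_perm_le_zigzagNumber`).

The hypothesis on odd multiplicities provides the path. The ends in λ and μ split into even ends and
pairs of equal ends, all of which become tails, and single odd ends (`exists_tails`). By parity
there are zero or two single ends; two of them serve as the ends of the path (`exists_path_ends`). A
bounded number K of further pairs of ends of weight 1 on each side brings the path weight to -1 and
restores the end counts, leaving M = m - K (`exists_hasZigzag`).

Finally n! ≥ M^n e^(-M) turns the product of factorials into the lower bound (2g + 4M)(ln M - 2) for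
the logarithm, uniformly in g; since K is fixed, the quotient has lower limit at least 1. -/

namespace TropicalCurve

/-! ### Vertex counts for tropical curves -/

variable (C : TropicalCurve)

theorem isLeaf_or_isInner (v : C.V) : C.IsLeaf v ∨ C.IsInner v := C.valence_eq v

open scoped Classical in
theorem valence_eq_card (v : C.V) :
    C.valence v = (Finset.univ.filter fun e => C.src e = v).card +
      (Finset.univ.filter fun e => C.tgt e = v).card := by
  simp [valence, Nat.card_eq_fintype_card, Fintype.card_subtype]

/-- The handshake lemma. -/
theorem sum_valence : ∑ v, C.valence v = 2 * Fintype.card C.E := by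
  classical
  have h (f : C.E → C.V) :
      ∑ v, (Finset.univ.filter fun e => f e = v).card = Fintype.card C.E :=
    (Finset.card_eq_sum_card_fiberwise (f := f) (s := Finset.univ) (t := Finset.univ)
      (fun _ _ => Finset.mem_coe.2 (Finset.mem_univ _))).symm
  simp only [valence_eq_card, Finset.sum_add_distrib, h]
  ring

open scoped Classical in
-- With L leaves, the handshake lemma reads 2|E| + 2L = 3|V|, and the genus formula eliminates |E|.
theorem card_vertices_le {g : ℕ} (hg : C.HasGenus g) :
    Fintype.card C.V ≤ 2 * (Finset.univ.filter fun v => C.IsLeaf v).card + 2 * g := by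
  have h1 : ∀ v, C.valence v + 2 * (if C.IsLeaf v then 1 else 0) = 3 := by
    intro v
    rcases C.isLeaf_or_isInner v with h | h
    · simp [h, show C.valence v = 1 from h]
    · have h3 : C.valence v = 3 := h
      simp [IsLeaf, h3]
  have h2 : ∑ v, (C.valence v + 2 * (if C.IsLeaf v then 1 else 0)) = 3 * Fintype.card C.V := by
    rw [Finset.sum_congr rfl fun v _ => h1 v]
    simp [mul_comm]
  rw [Finset.sum_add_distrib, C.sum_valence, ← Finset.mul_sum, ← Finset.card_filter] at h2
  unfold HasGenus at hg
  omega

end TropicalCurve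

theorem EReal.coe_ennreal_natCast (n : ℕ) : ((n : ℝ≥0∞) : EReal) = n := by
  rw [← ENNReal.coe_natCast, EReal.coe_nnreal_eq_coe_real, NNReal.coe_natCast,
    EReal.coe_natCast]

/-! ### Finiteness of the set of isomorphism classes -/

namespace TropicalCover

variable {g : ℕ} {lam mu : Multiset ℕ} {t : ℕ} {z : Fin t → ℝ} (φ : TropicalCover g lam mu z)

theorem pos_src_lt (e : φ.C.E) : φ.pos (φ.C.src e) < φ.pos (φ.C.tgt e) := by
  rw [← EReal.sub_pos, φ.slope e, ← EReal.coe_ennreal_natCast, ← EReal.coe_ennreal_mul,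
    EReal.coe_ennreal_pos]
  exact ENNReal.mul_pos (by simpa using (φ.weight_pos e).ne') (φ.C.len_pos e).ne'

theorem exists_pos_eq {v : φ.C.V} (hv : φ.C.IsInner v) : ∃ i, φ.pos v = (z i : EReal) := by
  have : φ.pos v ∈ Set.range fun i => ((z i : ℝ) : EReal) :=
    φ.image_inner ▸ Set.mem_image_of_mem _ hv
  obtain ⟨i, hi⟩ := this
  exact ⟨i, hi.symm⟩

theorem pos_mem (v : φ.C.V) :
    φ.pos v ∈ insert ⊥ (insert ⊤ (Set.range fun i => ((z i : ℝ) : EReal))) := by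
  rcases φ.C.isLeaf_or_isInner v with h | h
  · rcases φ.image_leaf v h with h | h <;> simp [h]
  · obtain ⟨i, hi⟩ := φ.exists_pos_eq h
    simp [hi]

theorem exists_incident (v : φ.C.V) : ∃ e, φ.C.Incident e v := by
  by_contra! h
  have h0 : φ.C.valence v = 0 := by
    rw [φ.C.valence_eq_card]
    simp only [TropicalCurve.Incident, not_or] at h
    simp [h]
  rcases φ.C.isLeaf_or_isInner v with h | h
  · exact absurd (h0.symm.trans h) (by norm_num)
  · exact absurd (h0.symm.trans h) (by norm_num)

open scoped Classical in
theorem card_leaves_le :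
    (Finset.univ.filter fun v => φ.C.IsLeaf v).card ≤ lam.card + mu.card := by
  have h : (Finset.univ.filter fun v => φ.C.IsLeaf v) ⊆
      (Finset.univ.filter fun e => φ.pos (φ.C.src e) = ⊥).image φ.C.src ∪
        (Finset.univ.filter fun e => φ.pos (φ.C.tgt e) = ⊤).image φ.C.tgt := by
    intro v hv
    obtain ⟨e, he⟩ := φ.exists_incident v
    have hlt := φ.pos_src_lt e
    simp only [Finset.mem_filter, Finset.mem_univ, true_and] at hv
    simp only [Finset.mem_union, Finset.mem_image, Finset.mem_filter, Finset.mem_univ, true_and]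
    rcases φ.image_leaf v hv with hp | hp <;> rcases he with he | he <;> subst he
    · exact Or.inl ⟨e, hp, rfl⟩
    · rw [hp] at hlt; exact absurd hlt not_lt_bot
    · rw [hp] at hlt; exact absurd hlt not_top_lt
    · exact Or.inr ⟨e, hp, rfl⟩
  have h1 := congrArg Multiset.card φ.left_ends
  have h2 := congrArg Multiset.card φ.right_ends
  rw [Multiset.card_map] at h1 h2
  calc _ ≤ _ := Finset.card_le_card h
    _ ≤ _ := Finset.card_union_le _ _
    _ ≤ _ := add_le_add Finset.card_image_le Finset.card_image_le
    _ = _ := congrArg₂ _ h1 h2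

/-- A cut argument: let A be the inner vertices lying no higher than the lower endpoint of `e₀`.
Summed over A, balancing equates inflow and outflow. The edge `e₀` leaves A, while everything
entering A from outside comes from -∞. -/
theorem weight_le (e₀ : φ.C.E) : φ.weight e₀ ≤ lam.sum := by
  classical
  have hsum : ∑ e with φ.pos (φ.C.src e) = ⊥, φ.weight e = lam.sum := by
    convert congrArg Multiset.sum φ.left_ends
    simp only [Finset.sum]
  by_cases h0 : φ.pos (φ.C.src e₀) = ⊥
  · rw [← hsum]
    exact Finset.single_le_sum (f := φ.weight) (fun _ _ => Nat.zero_le _) (by simp [h0])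
  set A : Finset φ.C.V :=
    Finset.univ.filter fun v => φ.C.IsInner v ∧ φ.pos v ≤ φ.pos (φ.C.src e₀) with hA
  have hfib (f : φ.C.E → φ.C.V) :
      ∑ v ∈ A, ∑ e with f e = v, φ.weight e = ∑ e with f e ∈ A, φ.weight e := by
    rw [← Finset.sum_fiberwise_of_maps_to (s := Finset.univ.filter fun e => f e ∈ A) (t := A)
      (g := f) (by simp)]
    refine Finset.sum_congr rfl fun v hv => Finset.sum_congr ?_ fun _ _ => rfl
    ext e
    simp only [Finset.mem_filter, Finset.mem_univ, true_and]
    exact ⟨fun h => ⟨h ▸ hv, h⟩, And.right⟩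
  have hbal : ∑ e with φ.C.tgt e ∈ A, φ.weight e = ∑ e with φ.C.src e ∈ A, φ.weight e := by
    rw [← hfib, ← hfib]
    refine Finset.sum_congr rfl fun v hv => ?_
    have := φ.balanced v (Finset.mem_filter.1 hv).2.1
    convert this
  have hsrcA : φ.C.src e₀ ∈ A := by
    simp only [hA, Finset.mem_filter, Finset.mem_univ, true_and, le_refl, and_true]
    rcases φ.C.isLeaf_or_isInner (φ.C.src e₀) with h | h
    · rcases φ.image_leaf _ h with hp | hp
      · exact absurd hp h0
      · have := φ.pos_src_lt e₀
        rw [hp] at this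
        exact absurd this not_top_lt
    · exact h
  have htgtA : φ.C.tgt e₀ ∉ A := by
    simp only [hA, Finset.mem_filter, Finset.mem_univ, true_and, not_and, not_le]
    exact fun _ => φ.pos_src_lt e₀
  -- An edge into A whose lower endpoint is inner has that endpoint in A as well, because positions
  -- increase along edges.
  have h1 : ∑ e with φ.C.tgt e ∈ A, φ.weight e ≤
      ∑ e with φ.C.src e ∈ A ∧ φ.C.tgt e ∈ A, φ.weight e + lam.sum := by
    rw [← hsum]
    refine le_trans (Finset.sum_le_sum_of_subset (t := Finset.univ.filter
      (fun e => φ.C.src e ∈ A ∧ φ.C.tgt e ∈ A) ∪ Finset.univ.filter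
      (fun e => φ.pos (φ.C.src e) = ⊥)) ?_) (Finset.sum_union_inter (f := φ.weight) ▸ le_self_add)
    intro e he
    simp only [Finset.mem_filter, Finset.mem_univ, true_and, Finset.mem_union] at he ⊢
    have hlt := φ.pos_src_lt e
    by_cases hb : φ.pos (φ.C.src e) = ⊥
    · exact Or.inr hb
    refine Or.inl ⟨?_, he⟩
    simp only [hA, Finset.mem_filter, Finset.mem_univ, true_and] at he ⊢
    refine ⟨?_, hlt.le.trans he.2⟩
    rcases φ.C.isLeaf_or_isInner (φ.C.src e) with h | h
    · rcases φ.image_leaf _ h with hp | hp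
      · exact absurd hp hb
      · rw [hp] at hlt
        exact absurd hlt not_top_lt
    · exact h
  have h2 : φ.weight e₀ + ∑ e with φ.C.src e ∈ A ∧ φ.C.tgt e ∈ A, φ.weight e ≤
      ∑ e with φ.C.src e ∈ A, φ.weight e := by
    rw [← Finset.sum_insert (f := φ.weight) (by simp [htgtA])]
    refine Finset.sum_le_sum_of_subset fun e he => ?_
    simp only [Finset.mem_insert, Finset.mem_filter, Finset.mem_univ, true_and] at he ⊢
    rcases he with rfl | he
    · exact hsrcA
    · exact he.1
  omega

/-- Combinatorial data determining a cover up to isomorphism. -/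
structure IsCodedBy {a b : ℕ} (s t' : Fin b → Fin a) (p : Fin a → EReal) (w : Fin b → ℕ)
    (av : φ.C.V ≃ Fin a) (be : φ.C.E ≃ Fin b) : Prop where
  src : ∀ e, s (be e) = av (φ.C.src e)
  tgt : ∀ e, t' (be e) = av (φ.C.tgt e)
  pos : ∀ v, p (av v) = φ.pos v
  weight : ∀ e, w (be e) = φ.weight e

variable {φ} in
-- Lengths need not be part of the code: the slope equation recovers them from positions and
-- weights, infinite lengths included, since weights are finite and non-zero.
theorem IsCodedBy.isomorphic {ψ : TropicalCover g lam mu z} {a b : ℕ} {s t' : Fin b → Fin a}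
    {p : Fin a → EReal} {w : Fin b → ℕ} {av : φ.C.V ≃ Fin a} {be : φ.C.E ≃ Fin b}
    {av' : ψ.C.V ≃ Fin a} {be' : ψ.C.E ≃ Fin b} (h : φ.IsCodedBy s t' p w av be)
    (h' : ψ.IsCodedBy s t' p w av' be') : φ.Isomorphic ψ := by
  have hs : ∀ e, ψ.C.src ((be.trans be'.symm) e) = (av.trans av'.symm) (φ.C.src e) := fun e => by
    have := h'.src (be'.symm (be e))
    rw [Equiv.apply_symm_apply, h.src] at this
    simp [this]
  have ht : ∀ e, ψ.C.tgt ((be.trans be'.symm) e) = (av.trans av'.symm) (φ.C.tgt e) := fun e => by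
    have := h'.tgt (be'.symm (be e))
    rw [Equiv.apply_symm_apply, h.tgt] at this
    simp [this]
  have hp : ∀ v, ψ.pos ((av.trans av'.symm) v) = φ.pos v := fun v => by
    have := h'.pos (av'.symm (av v))
    rw [Equiv.apply_symm_apply, h.pos] at this
    simp [this]
  have hw : ∀ e, ψ.weight ((be.trans be'.symm) e) = φ.weight e := fun e => by
    have := h'.weight (be'.symm (be e))
    rw [Equiv.apply_symm_apply, h.weight] at this
    simp [this]
  refine ⟨av.trans av'.symm, be.trans be'.symm, hs, ht, fun e => ?_, hp, hw⟩
  have key := ψ.slope (be.trans be'.symm e)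
  rw [hs, ht, hp, hp, hw, φ.slope e] at key
  rw [← EReal.coe_ennreal_natCast, ← EReal.coe_ennreal_mul, ← EReal.coe_ennreal_mul, EReal.coe_ennreal_eq_coe_ennreal_iff]
    at key
  exact ((ENNReal.mul_right_inj (by simpa using (φ.weight_pos e).ne') (by simp)).1 key).symm

end TropicalCover

open TropicalCover in
-- Needed because the `finsum` in `zigzagNumber` would be 0 if there were infinitely many classes.
-- The numbers of vertices and edges, the positions and the weights all range over finite sets, so
-- there are finitely many codes.
instance ZigzagClass.finite (g : ℕ) (lam mu : Multiset ℕ) {t : ℕ} (z : Fin t → ℝ) :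
    Finite (ZigzagClass g lam mu z) := by
  classical
  set N := 2 * (lam.card + mu.card) + 2 * g
  let P : Set EReal := insert ⊥ (insert ⊤ (Set.range fun i => ((z i : ℝ) : EReal)))
  have hP : P.Finite := ((Set.finite_range _).insert _).insert _
  have : Finite P := hP
  let Code := Σ ab : Fin (N + 1) × Fin (N + g + 1), (Fin ab.2 → Fin ab.1) × (Fin ab.2 → Fin ab.1) ×
    (Fin ab.1 → P) × (Fin ab.2 → Fin (lam.sum + 1))
  have hcode (φ : TropicalCover g lam mu z) : ∃ c : Code, ∃ av be, φ.IsCodedBy c.2.1 c.2.2.1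
      (fun v => (c.2.2.2.1 v : EReal)) (fun e => (c.2.2.2.2 e : ℕ)) av be := by
    have hV : Fintype.card φ.C.V ≤ N :=
      (φ.C.card_vertices_le φ.genus).trans (by have := φ.card_leaves_le; omega)
    have hE : Fintype.card φ.C.E ≤ N + g := by
      have := φ.genus
      unfold TropicalCurve.HasGenus at this
      omega
    let av := Fintype.equivFin φ.C.V
    let be := Fintype.equivFin φ.C.E
    exact ⟨⟨(⟨_, Nat.lt_succ_of_le hV⟩, ⟨_, Nat.lt_succ_of_le hE⟩),
      fun e => av (φ.C.src (be.symm e)), fun e => av (φ.C.tgt (be.symm e)),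
      fun v => ⟨φ.pos (av.symm v), φ.pos_mem _⟩,
      fun e => ⟨φ.weight (be.symm e), Nat.lt_succ_of_le (φ.weight_le _)⟩⟩, av, be,
      by simp, by simp, by simp, by simp⟩
  choose code av be hc using hcode
  have hcongr {φ ψ : TropicalCover g lam mu z} {c c' : Code} {av av' be be'}
      (h : φ.IsCodedBy c.2.1 c.2.2.1 (fun v => (c.2.2.2.1 v : EReal))
        (fun e => (c.2.2.2.2 e : ℕ)) av be)
      (h' : ψ.IsCodedBy c'.2.1 c'.2.2.1 (fun v => (c'.2.2.2.1 v : EReal))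
        (fun e => (c'.2.2.2.2 e : ℕ)) av' be') (hcc : c = c') : φ.Isomorphic ψ := by
    subst hcc
    exact h.isomorphic h'
  refine Finite.of_injective (fun c : ZigzagClass g lam mu z => code (Quotient.out c).1) ?_
  intro c c' h
  rw [← Quotient.out_eq c, ← Quotient.out_eq c']
  apply Quotient.sound
  exact hcongr (hc _) (hc _) h

/-! ### The combinatorial model: a path with tails -/

noncomputable section

/-- The combinatorial data of a zigzag cover: a path with `n` inner vertices, the edges of which
carry the odd signed weights `flow 0, …, flow n`, and, for each of these vertices, a tail having
`height i` inner vertices. -/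
structure ZigzagData where
  n : ℕ
  flow : ℕ → ℤ
  height : ℕ → ℕ
  -- With a single inner vertex, the two ends of the path could form a symmetric fork.
  two_le : 2 ≤ n
  odd_flow : ∀ j, j ≤ n → Odd (flow j)
  flow_ne : ∀ i, i < n → flow (i + 1) ≠ flow i
  -- From height 2 on the tail contains a cycle, and the weight of a cycle has to be odd.
  odd_half : ∀ i, i < n → 2 ≤ height i → Odd ((flow (i + 1) - flow i) / 2)

namespace ZigzagData

open scoped Classical

variable (D : ZigzagData)

/-- The inner vertices: `(i, 0)` is the `i`-th vertex of the path, `(i, k)` with `k > 0` is the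
`k`-th vertex of the tail attached to it. -/
@[ext]
structure Inner where
  i : ℕ
  k : ℕ
  hi : i < D.n
  hk : k ≤ D.height i

/-- The vertices: the inner ones, the two leaves of the path, and the leaves of the tails. -/
inductive Vertex
  | inner (x : D.Inner)
  | pathEnd (b : Bool)
  | leaf (i c : ℕ) (hi : i < D.n) (hc : c ≤ D.height i % 2)

/-- The edges: those of the path, and for each inner vertex `(i, k)` the edge or the two edges
which lead from it to the far side of the tail. -/
inductive Edge
  | path (j : ℕ) (hj : j ≤ D.n)
  | tail (i k c : ℕ) (hi : i < D.n) (hk : k ≤ D.height i) (hc : c ≤ k % 2)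

def innerEquiv : D.Inner ≃ (i : Fin D.n) × Fin (D.height i + 1) where
  toFun x := ⟨⟨x.i, x.hi⟩, ⟨x.k, Nat.lt_succ_of_le x.hk⟩⟩
  invFun x := ⟨x.1, x.2, x.1.2, Nat.le_of_lt_succ x.2.2⟩
  left_inv _ := rfl
  right_inv _ := rfl

instance : Fintype D.Inner := Fintype.ofEquiv _ D.innerEquiv.symm

def vertexEquiv : D.Vertex ≃ D.Inner ⊕ Bool ⊕ (i : Fin D.n) × Fin (D.height i % 2 + 1) where
  toFun
    | .inner x => .inl x
    | .pathEnd b => .inr (.inl b)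
    | .leaf i c hi hc => .inr (.inr ⟨⟨i, hi⟩, ⟨c, Nat.lt_succ_of_le hc⟩⟩)
  invFun
    | .inl x => .inner x
    | .inr (.inl b) => .pathEnd b
    | .inr (.inr x) => .leaf x.1 x.2 x.1.2 (Nat.le_of_lt_succ x.2.2)
  left_inv v := by cases v <;> rfl
  right_inv v := by rcases v with v | v | v <;> rfl

instance : Fintype D.Vertex := Fintype.ofEquiv _ D.vertexEquiv.symm

def edgeEquiv : D.Edge ≃
    Fin (D.n + 1) ⊕ (i : Fin D.n) × (k : Fin (D.height i + 1)) × Fin (k % 2 + 1) where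
  toFun
    | .path j hj => .inl ⟨j, Nat.lt_succ_of_le hj⟩
    | .tail i k c hi hk hc =>
      .inr ⟨⟨i, hi⟩, ⟨k, Nat.lt_succ_of_le hk⟩, ⟨c, Nat.lt_succ_of_le hc⟩⟩
  invFun
    | .inl j => .path j (Nat.le_of_lt_succ j.2)
    | .inr x => .tail x.1 x.2.1 x.2.2 x.1.2 (Nat.le_of_lt_succ x.2.1.2)
      (Nat.le_of_lt_succ x.2.2.2)
  left_inv v := by cases v <;> rfl
  right_inv v := by rcases v with v | v <;> rfl

instance : Fintype D.Edge := Fintype.ofEquiv _ D.edgeEquiv.symm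

theorem card_inner : Fintype.card D.Inner = ∑ i ∈ Finset.range D.n, (D.height i + 1) := by
  rw [Fintype.card_congr D.innerEquiv, Fintype.card_sigma,
    ← Fin.sum_univ_eq_sum_range (fun i => D.height i + 1)]
  simp

theorem card_vertex : Fintype.card D.Vertex =
    Fintype.card D.Inner + 2 + ∑ i ∈ Finset.range D.n, (D.height i % 2 + 1) := by
  rw [Fintype.card_congr D.vertexEquiv, Fintype.card_sum, Fintype.card_sum, Fintype.card_sigma,
    ← Fin.sum_univ_eq_sum_range (fun i => D.height i % 2 + 1)]
  simp [add_assoc]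

variable {D} in
theorem sum_edge {M : Type*} [AddCommMonoid M] {G : D.Edge → M} (P : ℕ → M) (Q : ℕ → ℕ → ℕ → M)
    (hP : ∀ j hj, G (.path j hj) = P j) (hQ : ∀ i k c hi hk hc, G (.tail i k c hi hk hc) = Q i k c) :
    ∑ e, G e = ∑ j ∈ Finset.range (D.n + 1), P j +
      ∑ i ∈ Finset.range D.n, ∑ k ∈ Finset.range (D.height i + 1),
        ∑ c ∈ Finset.range (k % 2 + 1), Q i k c := by
  rw [← D.edgeEquiv.symm.sum_comp, Fintype.sum_sum_type, Fintype.sum_sigma,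
    ← Fin.sum_univ_eq_sum_range,
    ← Fin.sum_univ_eq_sum_range (fun i => ∑ k ∈ Finset.range (D.height i + 1),
        ∑ c ∈ Finset.range (k % 2 + 1), Q i k c)]
  congr 1
  · exact Finset.sum_congr rfl fun j _ => hP _ _
  · refine Finset.sum_congr rfl fun i _ => ?_
    rw [Fintype.sum_sigma, ← Fin.sum_univ_eq_sum_range
      (fun k => ∑ c ∈ Finset.range (k % 2 + 1), Q i k c)]
    refine Finset.sum_congr rfl fun k _ => ?_
    rw [← Fin.sum_univ_eq_sum_range (fun c => Q i k c)]
    exact Finset.sum_congr rfl fun c _ => hQ _ _ _ _ _ _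

theorem card_edge : Fintype.card D.Edge =
    D.n + 1 + ∑ i ∈ Finset.range D.n, (D.height i + 1 + (D.height i + 1) / 2) := by
  have h : ∀ h : ℕ, ∑ k ∈ Finset.range (h + 1), (k % 2 + 1) = h + 1 + (h + 1) / 2 := by
    intro h
    induction h with
    | zero => simp
    | succ h ih => rw [Finset.sum_range_succ, ih]; omega
  rw [Fintype.card_eq_sum_ones, sum_edge (fun _ => 1) (fun _ _ _ => 1) (fun _ _ => rfl)
    (fun _ _ _ _ _ _ => rfl)]
  simp [h]

/-- This is the genus formula. A double edge at an odd level is a cycle unless the level is the last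
one, where it is a fork; a tail of height h thus has h / 2 cycles. -/
theorem card_edge_add_one : Fintype.card D.Edge + 1 =
    Fintype.card D.Vertex + ∑ i ∈ Finset.range D.n, D.height i / 2 := by
  have h : ∑ i ∈ Finset.range D.n, (D.height i + 1 + (D.height i + 1) / 2) +
      ∑ i ∈ Finset.range D.n, 1 =
      ∑ i ∈ Finset.range D.n, (D.height i + 1) + ∑ i ∈ Finset.range D.n, (D.height i % 2 + 1) +
        ∑ i ∈ Finset.range D.n, D.height i / 2 := by
    simp only [← Finset.sum_add_distrib]
    exact Finset.sum_congr rfl fun i _ => by omega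
  rw [Finset.sum_const, Finset.card_range, smul_eq_mul, mul_one] at h
  rw [card_edge, card_vertex, card_inner]
  omega

/-- The signed weight of the edge leading from a tail to the path. -/
def tailFlow (i : ℕ) : ℤ := D.flow (i + 1) - D.flow i

variable {D}

theorem tailFlow_ne {i : ℕ} (hi : i < D.n) : D.tailFlow i ≠ 0 := sub_ne_zero.2 (D.flow_ne i hi)

theorem even_tailFlow {i : ℕ} (hi : i < D.n) : Even (D.tailFlow i) :=
  (D.odd_flow _ hi).sub_odd (D.odd_flow _ hi.le)

theorem flow_ne_zero {j : ℕ} (hj : j ≤ D.n) : D.flow j ≠ 0 := by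
  intro h
  have := D.odd_flow j hj
  rw [h] at this
  exact absurd this (by decide)

theorem n_pos : 0 < D.n := lt_of_lt_of_le two_pos D.two_le

/-- The first vertex of an edge; paths are traversed in the order of the indices, and tails towards
the path. -/
def fst : D.Edge → D.Vertex
  | .path 0 _ => .pathEnd false
  | .path (j + 1) hj => .inner ⟨j, 0, hj, Nat.zero_le _⟩
  | .tail i k c hi _ hc => if h : k < D.height i then .inner ⟨i, k + 1, hi, h⟩ else
      -- The inner `if` keeps the leaf index in range without identifying `k` with the height; at
      -- the last level its value is always `c`.
      .leaf i (if D.height i % 2 = 0 then 0 else c) hi (by split_ifs <;> omega)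

/-- The second vertex of an edge. -/
def snd : D.Edge → D.Vertex
  | .path j _ => if h : j < D.n then .inner ⟨j, 0, h, Nat.zero_le _⟩ else .pathEnd true
  | .tail i k _ hi hk _ => .inner ⟨i, k, hi, hk⟩

/-- The signed weight of the edges at level `k` of the `i`-th tail. -/
def tailWeight (D : ZigzagData) (i k : ℕ) : ℤ :=
  if k % 2 = 0 then D.tailFlow i else D.tailFlow i / 2

theorem fst_path_of_pos {j : ℕ} (hj : j ≤ D.n) (h0 : 0 < j) : fst (.path j hj) =
    Vertex.inner (D := D) ⟨j - 1, 0, by omega, Nat.zero_le _⟩ := by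
  obtain ⟨j, rfl⟩ := Nat.exists_eq_succ_of_ne_zero h0.ne'
  rfl

/-- The weight of an edge, negative if the edge is traversed against its orientation. -/
def signed : D.Edge → ℤ
  | .path j _ => D.flow j
  | .tail i k _ _ _ _ => D.tailWeight i k

theorem tailWeight_pos_iff {i : ℕ} (hi : i < D.n) (k : ℕ) :
    0 < D.tailWeight i k ↔ 0 < D.tailFlow i := by
  obtain ⟨a, ha⟩ := even_tailFlow hi
  unfold tailWeight
  split_ifs <;> omega

theorem tailWeight_ne_zero {i : ℕ} (hi : i < D.n) (k : ℕ) : D.tailWeight i k ≠ 0 := by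
  obtain ⟨a, ha⟩ := even_tailFlow hi
  have := tailFlow_ne hi
  unfold tailWeight
  split_ifs <;> omega

theorem signed_ne_zero (e : D.Edge) : signed e ≠ 0 := by
  cases e with
  | path j hj => exact flow_ne_zero hj
  | tail i k c hi hk hc => exact tailWeight_ne_zero hi k

theorem filter_snd_inner_zero {i : ℕ} (hi : i < D.n) (h0 : 0 ≤ D.height i) :
    (Finset.univ.filter fun e : D.Edge => snd e = .inner ⟨i, 0, hi, h0⟩) =
      {.path i hi.le, .tail i 0 0 hi h0 le_rfl} := by
  ext e
  simp only [Finset.mem_filter, Finset.mem_univ, true_and]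
  cases e with
  | path j hj => simp only [snd]; split_ifs <;> simp <;> omega
  | tail j k c hj hk hc => simp [snd]; rintro rfl rfl; omega

theorem filter_fst_inner_zero {i : ℕ} (hi : i < D.n) (h0 : 0 ≤ D.height i) :
    (Finset.univ.filter fun e : D.Edge => fst e = .inner ⟨i, 0, hi, h0⟩) =
      {.path (i + 1) hi} := by
  ext e
  simp only [Finset.mem_filter, Finset.mem_univ, true_and]
  cases e with
  | path j hj => cases j <;> simp [fst]
  | tail j k c hj hk hc => simp only [fst]; split_ifs <;> simp

theorem filter_snd_inner_even {i k : ℕ} (hi : i < D.n) (hk : k + 1 ≤ D.height i)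
    (he : (k + 1) % 2 = 0) :
    (Finset.univ.filter fun e : D.Edge => snd e = .inner ⟨i, k + 1, hi, hk⟩) =
      {.tail i (k + 1) 0 hi hk (Nat.zero_le _)} := by
  ext e
  simp only [Finset.mem_filter, Finset.mem_univ, true_and]
  cases e with
  | path j hj => simp only [snd]; split_ifs <;> simp
  | tail j k c hj hk hc => simp [snd]; rintro rfl rfl; omega

theorem filter_snd_inner_odd {i k : ℕ} (hi : i < D.n) (hk : k + 1 ≤ D.height i)
    (he : (k + 1) % 2 = 1) :
    (Finset.univ.filter fun e : D.Edge => snd e = .inner ⟨i, k + 1, hi, hk⟩) =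
      {.tail i (k + 1) 0 hi hk (Nat.zero_le _), .tail i (k + 1) 1 hi hk he.ge} := by
  ext e
  simp only [Finset.mem_filter, Finset.mem_univ, true_and]
  cases e with
  | path j hj => simp only [snd]; split_ifs <;> simp
  | tail j k c hj hk hc => simp [snd, ← and_or_left]; rintro rfl rfl; omega

theorem filter_fst_inner_even {i k : ℕ} (hi : i < D.n) (hk : k + 1 ≤ D.height i)
    (he : (k + 1) % 2 = 0) :
    (Finset.univ.filter fun e : D.Edge => fst e = .inner ⟨i, k + 1, hi, hk⟩) =
      {.tail i k 0 hi (Nat.le_of_succ_le hk) (Nat.zero_le _),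
        .tail i k 1 hi (Nat.le_of_succ_le hk) (by omega)} := by
  ext e
  simp only [Finset.mem_filter, Finset.mem_univ, true_and]
  cases e with
  | path j hj => cases j <;> simp [fst]
  | tail j k c hj hk hc =>
    simp only [fst]; split_ifs
    · simp [← and_or_left]; rintro rfl rfl; omega
    · simp; constructor <;> (rintro rfl; omega)

theorem filter_fst_inner_odd {i k : ℕ} (hi : i < D.n) (hk : k + 1 ≤ D.height i)
    (he : (k + 1) % 2 = 1) :
    (Finset.univ.filter fun e : D.Edge => fst e = .inner ⟨i, k + 1, hi, hk⟩) =
      {.tail i k 0 hi (Nat.le_of_succ_le hk) (Nat.zero_le _)} := by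
  ext e
  simp only [Finset.mem_filter, Finset.mem_univ, true_and]
  cases e with
  | path j hj => cases j <;> simp [fst]
  | tail j k c hj hk hc =>
    simp only [fst]; split_ifs
    · simp; rintro rfl rfl; omega
    · simp; rintro rfl; omega

theorem filter_fst_leaf {i c : ℕ} (hi : i < D.n) (hc : c ≤ D.height i % 2) :
    (Finset.univ.filter fun e : D.Edge => fst e = .leaf i c hi hc) =
      {.tail i (D.height i) c hi le_rfl hc} := by
  ext e
  simp only [Finset.mem_filter, Finset.mem_univ, true_and]
  cases e with
  | path j hj => cases j <;> simp [fst]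
  | tail j k c hj hk hc =>
    simp only [fst]; split_ifs
    · simp; rintro rfl; omega
    · simp; rintro rfl; omega
    · simp; rintro rfl; omega

theorem filter_snd_leaf {i c : ℕ} (hi : i < D.n) (hc : c ≤ D.height i % 2) :
    (Finset.univ.filter fun e : D.Edge => snd e = .leaf i c hi hc) = ∅ := by
  ext e
  simp only [Finset.mem_filter, Finset.mem_univ, true_and]
  cases e with
  | path j hj => simp only [snd]; split_ifs <;> simp
  | tail j k c hj hk hc => simp [snd]

theorem filter_fst_pathEnd (b : Bool) :
    (Finset.univ.filter fun e : D.Edge => fst e = .pathEnd b) =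
      if b then ∅ else {.path 0 (Nat.zero_le _)} := by
  ext e
  simp only [Finset.mem_filter, Finset.mem_univ, true_and]
  cases e with
  | path j hj => cases j <;> cases b <;> simp [fst]
  | tail j k c hj hk hc => simp only [fst]; split_ifs <;> simp

theorem filter_snd_pathEnd (b : Bool) :
    (Finset.univ.filter fun e : D.Edge => snd e = .pathEnd b) =
      if b then {.path D.n le_rfl} else ∅ := by
  ext e
  simp only [Finset.mem_filter, Finset.mem_univ, true_and]
  cases e with
  | path j hj => simp only [snd]; split_ifs <;> cases b <;> simp at * <;> omega
  | tail j k c hj hk hc => cases b <;> simp [snd]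

/-- The lower endpoint of an edge. -/
def src (e : D.Edge) : D.Vertex := if 0 < signed e then fst e else snd e

/-- The upper endpoint of an edge. -/
def tgt (e : D.Edge) : D.Vertex := if 0 < signed e then snd e else fst e

/-- The weight of an edge. -/
def weight (e : D.Edge) : ℕ := (signed e).natAbs

/-- Reversing an edge does not change valences, so they can be counted in the traversal direction,
where the fibres are explicit. -/
theorem card_src_add_card_tgt (v : D.Vertex) :
    Nat.card {e : D.Edge // src e = v} + Nat.card {e : D.Edge // tgt e = v} =
      (Finset.univ.filter fun e : D.Edge => fst e = v).card +
        (Finset.univ.filter fun e : D.Edge => snd e = v).card := by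
  simp only [Nat.card_eq_fintype_card, Fintype.card_subtype, Finset.card_filter,
    ← Finset.sum_add_distrib]
  refine Finset.sum_congr rfl fun e _ => ?_
  unfold src tgt
  split_ifs <;> rfl

theorem valence_inner (x : D.Inner) :
    Nat.card {e : D.Edge // src e = .inner x} + Nat.card {e : D.Edge // tgt e = .inner x} = 3 := by
  obtain ⟨i, k, hi, hk⟩ := x
  rw [card_src_add_card_tgt]
  rcases k with _ | k
  · rw [filter_fst_inner_zero, filter_snd_inner_zero, Finset.card_singleton, Finset.card_pair]
    simp
  · rcases Nat.mod_two_eq_zero_or_one (k + 1) with h | h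
    · rw [filter_fst_inner_even hi hk h, filter_snd_inner_even hi hk h, Finset.card_singleton,
        Finset.card_pair]
      simp
    · rw [filter_fst_inner_odd hi hk h, filter_snd_inner_odd hi hk h, Finset.card_singleton,
        Finset.card_pair]
      simp

theorem valence_pathEnd (b : Bool) :
    Nat.card {e : D.Edge // src e = .pathEnd b} + Nat.card {e : D.Edge // tgt e = .pathEnd b} =
      1 := by
  rw [card_src_add_card_tgt, filter_fst_pathEnd, filter_snd_pathEnd]
  cases b <;> simp

theorem valence_leaf {i c : ℕ} (hi : i < D.n) (hc : c ≤ D.height i % 2) :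
    Nat.card {e : D.Edge // src e = .leaf i c hi hc} +
      Nat.card {e : D.Edge // tgt e = .leaf i c hi hc} = 1 := by
  rw [card_src_add_card_tgt, filter_fst_leaf, filter_snd_leaf]
  simp

/-- Conservation of the signed weights in the traversal direction is immediate from the definition
of `tailFlow`. Reversing an edge of negative signed weight changes both its side and its sign, so
the difference of the two sums is unaffected. -/
theorem balanced_inner (x : D.Inner) :
    ∑ e with tgt e = .inner x, weight e = ∑ e with src e = .inner x, weight e := by
  have key : ∑ e : D.Edge with snd e = .inner x, signed e = ∑ e with fst e = .inner x, signed e := by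
    obtain ⟨i, k, hi, hk⟩ := x
    obtain ⟨a, ha⟩ := even_tailFlow hi
    rcases k with _ | k
    · rw [filter_fst_inner_zero, filter_snd_inner_zero, Finset.sum_singleton, Finset.sum_pair]
      · simp [signed, tailWeight, tailFlow]
      · simp
    · rcases Nat.mod_two_eq_zero_or_one (k + 1) with h | h
      · rw [filter_fst_inner_even hi hk h, filter_snd_inner_even hi hk h, Finset.sum_singleton,
          Finset.sum_pair (by simp)]
        simp only [signed, tailWeight]
        split_ifs <;> omega
      · rw [filter_fst_inner_odd hi hk h, filter_snd_inner_odd hi hk h, Finset.sum_singleton,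
          Finset.sum_pair (by simp)]
        simp only [signed, tailWeight]
        split_ifs <;> omega
  zify
  rw [← sub_eq_zero] at key ⊢
  rw [← key]
  simp only [Finset.sum_filter, ← Finset.sum_sub_distrib]
  refine Finset.sum_congr rfl fun e _ => ?_
  have h0 := signed_ne_zero e
  unfold src tgt weight
  split_ifs <;> omega

end ZigzagData

/-! ### Realising the model as a tropical cover -/

theorem SimpleGraph.fromRel_reachable {V : Type*} {r : V → V → Prop} {u v : V} (h : r u v) :
    (SimpleGraph.fromRel r).Reachable u v := by
  by_cases huv : u = v
  · exact huv ▸ .refl u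
  · exact SimpleGraph.Adj.reachable ((SimpleGraph.fromRel_adj r u v).2 ⟨huv, Or.inl h⟩)

namespace ZigzagData

open scoped Classical

variable {D : ZigzagData}

theorem src_tgt_cases (e : D.Edge) :
    0 < signed e ∧ src e = fst e ∧ tgt e = snd e ∨
      ¬ 0 < signed e ∧ src e = snd e ∧ tgt e = fst e := by
  unfold src tgt
  split_ifs with h <;> simp [h]

theorem reachable_fst_snd {r : D.Vertex → D.Vertex → Prop} (e : D.Edge) (h : r (src e) (tgt e)) :
    (SimpleGraph.fromRel r).Reachable (snd e) (fst e) := by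
  rcases src_tgt_cases e with ⟨-, h1, h2⟩ | ⟨-, h1, h2⟩ <;> rw [h1, h2] at h
  · exact (SimpleGraph.fromRel_reachable h).symm
  · exact SimpleGraph.fromRel_reachable h

theorem connected : (SimpleGraph.fromRel fun u v : D.Vertex =>
    ∃ e : D.Edge, src e = u ∧ tgt e = v).Connected := by
  set G := SimpleGraph.fromRel fun u v : D.Vertex => ∃ e : D.Edge, src e = u ∧ tgt e = v
  have hr (e : D.Edge) : G.Reachable (snd e) (fst e) := reachable_fst_snd (r := fun u v => ∃ e, src e = u ∧ tgt e = v) e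
    ⟨e, rfl, rfl⟩
  have h0 : ∀ i (hi : i < D.n), G.Reachable
      (Vertex.inner ⟨0, 0, n_pos, Nat.zero_le _⟩) (Vertex.inner ⟨i, 0, hi, Nat.zero_le _⟩) := by
    intro i
    induction i with
    | zero => exact fun _ => .refl _
    | succ i ih =>
      intro hi
      have := hr (.path (i + 1) hi.le)
      simp only [snd, fst, hi, dif_pos] at this
      exact (ih _).trans this.symm
  have h1 : ∀ i (hi : i < D.n) k (hk : k ≤ D.height i), G.Reachable
      (Vertex.inner ⟨0, 0, n_pos, Nat.zero_le _⟩) (Vertex.inner ⟨i, k, hi, hk⟩) := by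
    intro i hi k
    induction k with
    | zero => exact fun _ => h0 i hi
    | succ k ih =>
      intro hk
      have := hr (.tail i k 0 hi (Nat.le_of_succ_le hk) (Nat.zero_le _))
      simp only [snd, fst, Nat.lt_of_succ_le hk, dif_pos] at this
      exact (ih _).trans this
  have : Nonempty D.Vertex := ⟨.pathEnd true⟩
  refine SimpleGraph.connected_iff_exists_forall_reachable _ |>.2
    ⟨.inner ⟨0, 0, n_pos, Nat.zero_le _⟩, fun v => ?_⟩
  rcases v with ⟨i, k, hi, hk⟩ | b | ⟨i, c, hi, hc⟩
  · exact h1 i hi k hk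
  · cases b
    · have := hr (.path 0 (Nat.zero_le _))
      simp only [snd, fst, n_pos, dif_pos] at this
      exact this
    · have := hr (.path D.n le_rfl)
      rw [fst_path_of_pos _ n_pos] at this
      simp only [snd, lt_irrefl, dif_neg, not_false_eq_true] at this
      exact (h0 _ _).trans this.symm
  · have := hr (.tail i (D.height i) c hi le_rfl hc)
    simp only [snd, fst, lt_irrefl, dif_neg, not_false_eq_true] at this
    have h3 : (if D.height i % 2 = 0 then 0 else c) = c := by split_ifs <;> omega
    simp only [h3] at this
    exact (h1 _ _ _ _).trans this

/-- The vertices that are not inner are on the lower or the upper side. -/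
inductive IsLow : D.Vertex → Prop
  | pathStart (h : 0 < D.flow 0) : IsLow (.pathEnd false)
  | pathEnd (h : ¬ 0 < D.flow D.n) : IsLow (.pathEnd true)
  | leaf (i c hi hc) (h : 0 < D.tailFlow i) : IsLow (.leaf i c hi hc)

inductive IsHigh : D.Vertex → Prop
  | pathStart (h : ¬ 0 < D.flow 0) : IsHigh (.pathEnd false)
  | pathEnd (h : 0 < D.flow D.n) : IsHigh (.pathEnd true)
  | leaf (i c hi hc) (h : ¬ 0 < D.tailFlow i) : IsHigh (.leaf i c hi hc)

/-- No edge joins two leaves, because the path has an inner vertex. These are the cases in which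
lengths and slopes are computed. -/
theorem edge_cases (e : D.Edge) :
    (∃ x y, src e = .inner x ∧ tgt e = .inner y) ∨ (∃ y, IsLow (src e) ∧ tgt e = .inner y) ∨
      (∃ x, src e = .inner x ∧ IsHigh (tgt e)) := by
  rcases e with ⟨j, hj⟩ | ⟨i, k, c, hi, hk, hc⟩
  · by_cases h : 0 < D.flow j <;> simp only [src, tgt, signed, h, if_true, if_false] <;>
    · rcases j with _ | j
      · simp only [fst, snd, n_pos, dif_pos]
        first
        | exact Or.inr (Or.inl ⟨_, .pathStart h, rfl⟩)
        | exact Or.inr (Or.inr ⟨_, rfl, .pathStart h⟩)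
      · rcases hj.lt_or_eq with hj' | hj'
        · simp only [fst, snd, hj', dif_pos]
          exact Or.inl ⟨_, _, rfl, rfl⟩
        · simp only [fst, snd, hj', lt_irrefl, dif_neg, not_false_eq_true]
          rw [hj'] at h
          first
          | exact Or.inr (Or.inl ⟨_, .pathEnd h, rfl⟩)
          | exact Or.inr (Or.inr ⟨_, rfl, .pathEnd h⟩)
  · by_cases h : 0 < D.tailFlow i <;>
      simp only [src, tgt, signed, tailWeight_pos_iff hi, h, if_true, if_false] <;>
    · rcases hk.lt_or_eq with hk' | hk'
      · simp only [fst, snd, hk', dif_pos]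
        exact Or.inl ⟨_, _, rfl, rfl⟩
      · simp only [fst, snd, hk', lt_irrefl, dif_neg, not_false_eq_true]
        first
        | exact Or.inr (Or.inl ⟨_, .leaf _ _ _ _ h, rfl⟩)
        | exact Or.inr (Or.inr ⟨_, rfl, .leaf _ _ _ _ h⟩)

/-- The valence of a vertex. -/
def valence (v : D.Vertex) : ℕ :=
  Nat.card {e : D.Edge // src e = v} + Nat.card {e : D.Edge // tgt e = v}

theorem IsLow.valence {v : D.Vertex} (h : IsLow v) : valence v = 1 := by
  cases h with
  | pathStart => exact valence_pathEnd _
  | pathEnd => exact valence_pathEnd _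
  | leaf => exact valence_leaf _ _

theorem IsHigh.valence {v : D.Vertex} (h : IsHigh v) : valence v = 1 := by
  cases h with
  | pathStart => exact valence_pathEnd _
  | pathEnd => exact valence_pathEnd _
  | leaf => exact valence_leaf _ _

variable {t : ℕ} {z : Fin t → ℝ}

/-- The images of the vertices if `q` gives those of the inner ones. -/
def pos (q : D.Inner → ℝ) : D.Vertex → EReal
  | .inner x => q x
  | v => if IsLow v then ⊥ else ⊤

theorem IsLow.pos {v : D.Vertex} (h : IsLow v) (q : D.Inner → ℝ) : pos q v = ⊥ := by
  cases h <;> exact if_pos (by constructor; assumption)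

theorem IsHigh.pos {v : D.Vertex} (h : IsHigh v) (q : D.Inner → ℝ) : pos q v = ⊤ := by
  cases h <;>
  · refine if_neg ?_
    rintro ⟨⟩
    contradiction

/-- The length of an edge. -/
def len (q : D.Inner → ℝ) (e : D.Edge) : ℝ≥0∞ :=
  match src e, tgt e with
  | .inner x, .inner y => ENNReal.ofReal ((q y - q x) / weight e)
  | _, _ => ⊤

theorem len_inner (q : D.Inner → ℝ) {e : D.Edge} {x y : D.Inner} (hx : src e = .inner x)
    (hy : tgt e = .inner y) : len q e = ENNReal.ofReal ((q y - q x) / weight e) := by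
  unfold len; rw [hx, hy]

theorem IsLow.len {q : D.Inner → ℝ} {e : D.Edge} (h : IsLow (src e)) : len q e = ⊤ := by
  unfold ZigzagData.len
  generalize src e = v at *
  cases h <;> rfl

theorem IsHigh.len {q : D.Inner → ℝ} {e : D.Edge} (h : IsHigh (tgt e)) : len q e = ⊤ := by
  unfold ZigzagData.len
  generalize tgt e = v at *
  generalize src e = u at *
  cases h <;> cases u <;> rfl

theorem weight_pos (e : D.Edge) : 0 < weight e := Int.natAbs_pos.2 (signed_ne_zero e)

/-- The tropical curve given by `D` and the positions of the inner vertices. -/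
def curve (q : D.Inner → ℝ)
    (hq : ∀ (e : D.Edge) x y, src e = .inner x → tgt e = .inner y → q x < q y) : TropicalCurve where
  V := D.Vertex
  E := D.Edge
  src := src
  tgt := tgt
  len := len q
  connected := connected
  valence_eq v := by
    rcases v with x | b | ⟨i, c, hi, hc⟩
    · exact Or.inr (valence_inner x)
    · exact Or.inl (valence_pathEnd b)
    · exact Or.inl (valence_leaf hi hc)
  len_pos e := by
    rcases edge_cases e with ⟨x, y, hx, hy⟩ | ⟨y, h, hy⟩ | ⟨x, hx, h⟩
    · rw [len_inner q hx hy, ENNReal.ofReal_pos]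
      exact div_pos (sub_pos.2 (hq e x y hx hy)) (Nat.cast_pos.2 (weight_pos e))
    · rw [h.len]; exact ENNReal.zero_lt_top
    · rw [h.len]; exact ENNReal.zero_lt_top
  len_top e := by
    change _ ↔ valence (src e) = 1 ∨ valence (tgt e) = 1
    rcases edge_cases e with ⟨x, y, hx, hy⟩ | ⟨y, h, hy⟩ | ⟨x, hx, h⟩
    · have h3 (x : D.Inner) : valence (.inner x) = 3 := valence_inner x
      simp [len_inner q hx hy, hx, hy, h3]
    · simp [h.len, h.valence]
    · simp [h.len, h.valence]

variable {q : D.Inner → ℝ}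
  (hq : ∀ (e : D.Edge) x y, src e = .inner x → tgt e = .inner y → q x < q y)

theorem curve_isInner_iff (v : D.Vertex) : (curve q hq).IsInner v ↔ ∃ x, v = .inner x := by
  rcases v with x | b | ⟨i, c, hi, hc⟩
  · exact ⟨fun _ => ⟨x, rfl⟩, fun _ => valence_inner x⟩
  · simp [TropicalCurve.IsInner, show (curve q hq).valence (Vertex.pathEnd b) = 1 from
      valence_pathEnd b]
  · simp [TropicalCurve.IsInner, show (curve q hq).valence (Vertex.leaf i c hi hc) = 1 from
      valence_leaf hi hc]

theorem curve_isLeaf_iff (v : D.Vertex) : (curve q hq).IsLeaf v ↔ IsLow v ∨ IsHigh v := by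
  rcases v with x | b | ⟨i, c, hi, hc⟩
  · have h3 : (curve q hq).valence (Vertex.inner x) = 3 := valence_inner x
    simp only [TropicalCurve.IsLeaf, h3]
    constructor
    · intro h; omega
    · rintro (h | h) <;> cases h
  · refine iff_of_true (valence_pathEnd b) ?_
    cases b
    · exact (em (0 < D.flow 0)).imp .pathStart .pathStart
    · exact (em' (0 < D.flow D.n)).imp .pathEnd .pathEnd
  · exact iff_of_true (valence_leaf hi hc) ((em (0 < D.tailFlow i)).imp (.leaf _ _ _ _)
      (.leaf _ _ _ _))

/-- The weights of the ends of `i`-th tail. -/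
def tailEnds (D : ZigzagData) (i : ℕ) : Multiset ℕ :=
  Multiset.replicate (D.height i % 2 + 1) (D.tailWeight i (D.height i)).natAbs

/-- The weights of the lower ends. -/
def leftEnds (D : ZigzagData) : Multiset ℕ :=
  (if 0 < D.flow 0 then {(D.flow 0).natAbs} else 0) +
    (if D.flow D.n < 0 then {(D.flow D.n).natAbs} else 0) +
    ∑ i ∈ Finset.range D.n, if 0 < D.tailFlow i then D.tailEnds i else 0

/-- The weights of the upper ends. -/
def rightEnds (D : ZigzagData) : Multiset ℕ :=
  (if D.flow 0 < 0 then {(D.flow 0).natAbs} else 0) +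
    (if 0 < D.flow D.n then {(D.flow D.n).natAbs} else 0) +
    ∑ i ∈ Finset.range D.n, if D.tailFlow i < 0 then D.tailEnds i else 0

theorem map_weight_filter (p : D.Edge → Prop) [DecidablePred p] :
    (Finset.univ.filter p).val.map weight = ∑ e : D.Edge, if p e then {weight e} else 0 := by
  rw [← Finset.sum_filter, Finset.sum, ← Multiset.sum_map_singleton
    ((Finset.univ.filter p).val.map weight), Multiset.map_map]
  rfl

theorem pos_eq_bot_iff (q : D.Inner → ℝ) (v : D.Vertex) : pos q v = ⊥ ↔ IsLow v := by
  refine ⟨fun h => ?_, fun h => h.pos q⟩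
  by_contra hv
  cases v <;> simp [pos, hv] at h

theorem pos_eq_top_iff (q : D.Inner → ℝ) (v : D.Vertex) : pos q v = ⊤ ↔ IsHigh v := by
  refine ⟨fun h => ?_, fun h => h.pos q⟩
  rcases v with x | b | ⟨i, c, hi, hc⟩
  · simp [pos] at h
  · cases b
    · by_contra hv
      have hl : IsLow (.pathEnd false : D.Vertex) :=
        .pathStart (by by_contra h0; exact hv (.pathStart h0))
      simp [hl.pos] at h
    · by_contra hv
      have hl : IsLow (.pathEnd true : D.Vertex) :=
        .pathEnd (by by_contra h0; exact hv (.pathEnd (by simpa using h0)))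
      simp [hl.pos] at h
  · by_contra hv
    have hl : IsLow (.leaf i c hi hc : D.Vertex) :=
      .leaf _ _ _ _ (by by_contra h0; exact hv (.leaf _ _ _ _ h0))
    simp [hl.pos] at h

@[simp] theorem not_isLow_inner (x : D.Inner) : ¬ IsLow (.inner x) := nofun

@[simp] theorem not_isHigh_inner (x : D.Inner) : ¬ IsHigh (.inner x) := nofun

@[simp] theorem isLow_pathEnd_iff (b : Bool) :
    IsLow (.pathEnd b : D.Vertex) ↔ if b then ¬ 0 < D.flow D.n else 0 < D.flow 0 := by
  constructor
  · intro h
    cases h with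
    | pathStart h => simpa using h
    | pathEnd h => simpa using h
  · cases b
    · exact .pathStart
    · exact .pathEnd

@[simp] theorem isHigh_pathEnd_iff (b : Bool) :
    IsHigh (.pathEnd b : D.Vertex) ↔ if b then 0 < D.flow D.n else ¬ 0 < D.flow 0 := by
  constructor
  · intro h
    cases h with
    | pathStart h => simpa using h
    | pathEnd h => simpa using h
  · cases b
    · exact .pathStart
    · exact .pathEnd

@[simp] theorem isLow_leaf_iff {i c : ℕ} (hi : i < D.n) (hc : c ≤ D.height i % 2) :
    IsLow (.leaf i c hi hc : D.Vertex) ↔ 0 < D.tailFlow i :=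
  ⟨by rintro ⟨⟩; assumption, .leaf _ _ _ _⟩

@[simp] theorem isHigh_leaf_iff {i c : ℕ} (hi : i < D.n) (hc : c ≤ D.height i % 2) :
    IsHigh (.leaf i c hi hc : D.Vertex) ↔ ¬ 0 < D.tailFlow i :=
  ⟨by rintro ⟨⟩; assumption, .leaf _ _ _ _⟩

theorem isLow_src_path_iff {j : ℕ} (hj : j ≤ D.n) :
    IsLow (src (.path j hj)) ↔ j = 0 ∧ 0 < D.flow 0 ∨ j = D.n ∧ D.flow D.n < 0 := by
  have hn := D.n_pos
  have h0 := flow_ne_zero hj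
  rcases src_tgt_cases (.path j hj) with ⟨h, hs, -⟩ | ⟨h, hs, -⟩ <;> rw [hs] <;>
    simp only [signed] at h
  · rcases j with _ | j
    · simp [fst, h, hn.ne]
    · simp only [fst, not_isLow_inner, false_iff]
      rintro (⟨h1, -⟩ | ⟨h1, h2⟩)
      · omega
      · rw [← h1] at h2; omega
  · simp only [snd]
    split_ifs with h1
    · simp only [not_isLow_inner, false_iff]
      rintro (⟨rfl, h2⟩ | ⟨h2, -⟩) <;> omega
    · have : j = D.n := by omega
      subst this
      simp [h, hn.ne', lt_of_le_of_ne (not_lt.1 h) h0]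

theorem isHigh_tgt_path_iff {j : ℕ} (hj : j ≤ D.n) :
    IsHigh (tgt (.path j hj)) ↔ j = 0 ∧ D.flow 0 < 0 ∨ j = D.n ∧ 0 < D.flow D.n := by
  have hn := D.n_pos
  have h0 := flow_ne_zero hj
  rcases src_tgt_cases (.path j hj) with ⟨h, -, hs⟩ | ⟨h, -, hs⟩ <;> rw [hs] <;>
    simp only [signed] at h
  · simp only [snd]
    split_ifs with h1
    · simp only [not_isHigh_inner, false_iff]
      rintro (⟨rfl, h2⟩ | ⟨h2, -⟩) <;> omega
    · have : j = D.n := by omega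
      subst this
      simp [h, hn.ne']
  · rcases j with _ | j
    · simp [fst, h, hn.ne, lt_of_le_of_ne (not_lt.1 h) h0]
    · simp only [fst, not_isHigh_inner, false_iff]
      rintro (⟨h1, -⟩ | ⟨h1, h2⟩)
      · omega
      · rw [← h1] at h2; omega

theorem isLow_src_tail_iff {i k c : ℕ} (hi : i < D.n) (hk : k ≤ D.height i) (hc : c ≤ k % 2) :
    IsLow (src (.tail i k c hi hk hc)) ↔ k = D.height i ∧ 0 < D.tailFlow i := by
  rcases src_tgt_cases (.tail i k c hi hk hc) with ⟨h, hs, -⟩ | ⟨h, hs, -⟩ <;> rw [hs] <;>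
    simp only [signed, tailWeight_pos_iff hi] at h
  · simp only [fst]
    split_ifs with h1
    · simp [h, h1.ne]
    all_goals simp [h, show k = D.height i by omega]
  · simp [snd, h]

theorem isHigh_tgt_tail_iff {i k c : ℕ} (hi : i < D.n) (hk : k ≤ D.height i) (hc : c ≤ k % 2) :
    IsHigh (tgt (.tail i k c hi hk hc)) ↔ k = D.height i ∧ D.tailFlow i < 0 := by
  have h0 := tailFlow_ne hi
  rcases src_tgt_cases (.tail i k c hi hk hc) with ⟨h, -, hs⟩ | ⟨h, -, hs⟩ <;> rw [hs] <;>
    simp only [signed, tailWeight_pos_iff hi] at h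
  · simp [snd, h.le]
  · have h' := lt_of_le_of_ne (not_lt.1 h) h0
    simp only [fst]
    split_ifs with h1
    · simp [h1.ne]
    all_goals simp [h, h', show k = D.height i by omega]

/-- Lower and upper ends are treated at once: in both cases only the first and last path edges and
the last levels of the tails can satisfy `p`. -/
theorem sum_ends (A B : Prop) [Decidable A] [Decidable B] (C : ℕ → Prop) [DecidablePred C]
    (p : D.Edge → Prop) [DecidablePred p]
    (hP : ∀ j hj, p (.path j hj) ↔ j = 0 ∧ A ∨ j = D.n ∧ B)
    (hQ : ∀ i k c hi hk hc, p (.tail i k c hi hk hc) ↔ k = D.height i ∧ C i) :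
    (Finset.univ.filter p).val.map weight =
      (if A then {(D.flow 0).natAbs} else 0) + (if B then {(D.flow D.n).natAbs} else 0) +
        ∑ i ∈ Finset.range D.n, if C i then D.tailEnds i else 0 := by
  have hn := D.n_pos
  rw [map_weight_filter, sum_edge
    (fun j => (if j = 0 then if A then {(D.flow 0).natAbs} else 0 else 0) +
      (if j = D.n then if B then {(D.flow D.n).natAbs} else 0 else 0))
    (fun i k _ => if k = D.height i then
      if C i then {(D.tailWeight i (D.height i)).natAbs} else 0 else 0)]
  · congr 1
    · rw [Finset.sum_add_distrib, Finset.sum_ite_eq', Finset.sum_ite_eq']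
      simp
    · refine Finset.sum_congr rfl fun i _ => ?_
      simp only [Finset.sum_const, Finset.card_range, smul_ite, smul_zero]
      rw [Finset.sum_ite_eq']
      simp [tailEnds, Multiset.nsmul_singleton]
  · intro j hj
    simp only [hP]
    by_cases h0 : j = 0
    · subst h0
      simp [hn.ne, weight, signed]
    · by_cases h1 : j = D.n
      · subst h1
        simp [h0, weight, signed]
      · simp [h0, h1]
  · intro i k c hi hk hc
    simp only [hQ]
    by_cases h0 : k = D.height i
    · subst h0
      simp [weight, signed]
    · simp [h0]

theorem map_weight_left (q : D.Inner → ℝ) :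
    (Finset.univ.filter fun e : D.Edge => pos q (src e) = ⊥).val.map weight = D.leftEnds := by
  simp only [pos_eq_bot_iff]
  exact sum_ends _ _ _ _ (fun j hj => isLow_src_path_iff hj)
    (fun i k c hi hk hc => isLow_src_tail_iff hi hk hc)

theorem map_weight_right (q : D.Inner → ℝ) :
    (Finset.univ.filter fun e : D.Edge => pos q (tgt e) = ⊤).val.map weight = D.rightEnds := by
  simp only [pos_eq_top_iff]
  exact sum_ends _ _ _ _ (fun j hj => isHigh_tgt_path_iff hj)
    (fun i k c hi hk hc => isHigh_tgt_tail_iff hi hk hc)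

theorem image_pos_inner (p : D.Inner ≃ Fin t) :
    pos (fun x => z (p x)) '' {v : D.Vertex | ∃ x, v = .inner x} =
      Set.range fun i => ((z i : ℝ) : EReal) := by
  ext y
  simp only [Set.mem_image, Set.mem_ofPred_eq, Set.mem_range]
  constructor
  · rintro ⟨_, ⟨x, rfl⟩, rfl⟩
    exact ⟨p x, rfl⟩
  · rintro ⟨i, rfl⟩
    exact ⟨_, ⟨p.symm i, rfl⟩, by simp [pos]⟩

/-- The tropical cover given by `D` and an ordering of the inner vertices. -/
def cover (hz : StrictMono z) (p : D.Inner ≃ Fin t)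
    (hp : ∀ (e : D.Edge) x y, src e = .inner x → tgt e = .inner y → p x < p y) :
    TropicalCover (∑ i ∈ Finset.range D.n, D.height i / 2) D.leftEnds D.rightEnds z where
  C := curve (fun x => z (p x)) fun e x y hx hy => hz (hp e x y hx hy)
  genus := D.card_edge_add_one
  pos := pos fun x => z (p x)
  weight := weight
  weight_pos := weight_pos
  image_inner := (congrArg (Set.image _) (Set.ext fun v => curve_isInner_iff _ v)).trans
    (image_pos_inner p)
  image_leaf v hv := ((curve_isLeaf_iff _ v).1 hv).imp (fun h => h.pos _) (fun h => h.pos _)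
  slope e := by
    have hw : (0 : EReal) < (weight e : EReal) := by exact_mod_cast weight_pos e
    change pos _ (tgt e) - pos _ (src e) = (weight e : EReal) * ((len _ e : ℝ≥0∞) : EReal)
    rcases edge_cases e with ⟨x, y, hx, hy⟩ | ⟨y, h, hy⟩ | ⟨x, hx, h⟩
    · have hpos : 0 < z (p y) - z (p x) := sub_pos.2 (hz (hp e x y hx hy))
      have hw' : (weight e : ℝ) ≠ 0 := by exact_mod_cast (weight_pos e).ne'
      rw [len_inner _ hx hy, hx, hy, EReal.coe_ennreal_ofReal, max_eq_left (by positivity)]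
      simp only [pos]
      rw [← EReal.coe_coe_eq_natCast, ← EReal.coe_mul, ← EReal.coe_sub, mul_div_cancel₀ _ hw']
    · rw [h.len, h.pos, hy, EReal.coe_ennreal_top, EReal.mul_top_of_pos hw]
      simp [pos]
    · rw [h.len, h.pos, hx, EReal.coe_ennreal_top, EReal.mul_top_of_pos hw]
      simp [pos]
  balanced v hv := by
    obtain ⟨x, rfl⟩ := (curve_isInner_iff _ v).1 hv
    exact balanced_inner x
  left_ends := map_weight_left _
  right_ends := map_weight_right _

end ZigzagData

/-! ### The covers are zigzag covers -/

namespace ZigzagData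

open scoped Classical

variable {D : ZigzagData} {t : ℕ} {z : Fin t → ℝ}

/-- The vertices of the path. -/
def IsSpine : D.Vertex → Prop
  | .inner x => x.k = 0
  | .pathEnd _ => True
  | .leaf _ _ _ _ => False

/-- The edges of the path. -/
def IsPath : D.Edge → Prop
  | .path _ _ => True
  | .tail _ _ _ _ _ _ => False

/-- The edges of the `i`-th tail from level `m` on. -/
def tailEdges (D : ZigzagData) (i m : ℕ) : Set D.Edge :=
  {e | ∃ k c hi hk hc, e = .tail i k c hi hk hc ∧ m ≤ k}

theorem isSpine_fst_snd {e : D.Edge} (h : IsPath e) : IsSpine (fst e) ∧ IsSpine (snd e) := by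
  rcases e with ⟨j, hj⟩ | _
  · constructor
    · cases j <;> simp [fst, IsSpine]
    · simp only [snd]; split_ifs <;> simp [IsSpine]
  · exact h.elim

theorem incident_iff (e : D.Edge) (v : D.Vertex) :
    src e = v ∨ tgt e = v ↔ fst e = v ∨ snd e = v := by
  rcases src_tgt_cases e with ⟨-, h1, h2⟩ | ⟨-, h1, h2⟩ <;> rw [h1, h2]
  exact or_comm

theorem joins_fst_snd (e : D.Edge) : s(src e, tgt e) = s(fst e, snd e) := by
  rcases src_tgt_cases e with ⟨-, h1, h2⟩ | ⟨-, h1, h2⟩ <;> rw [h1, h2]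
  exact Sym2.eq_swap

/-- The index of the tail to which a vertex belongs. -/
def tailIndex : D.Vertex → ℕ
  | .inner x => x.i
  | .pathEnd _ => 0
  | .leaf i _ _ _ => i

theorem mem_tailEdges_of_incident {e : D.Edge} {v : D.Vertex} (hv : ¬ IsSpine v)
    (h : src e = v ∨ tgt e = v) : e ∈ D.tailEdges (tailIndex v) 0 := by
  rw [incident_iff] at h
  rcases e with ⟨j, hj⟩ | ⟨i, k, c, hi, hk, hc⟩
  · have := isSpine_fst_snd (D := D) (e := .path j hj) trivial
    rcases h with rfl | rfl
    · exact absurd this.1 hv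
    · exact absurd this.2 hv
  · have : tailIndex v = i := by
      rcases h with rfl | rfl
      · simp only [fst]; split_ifs <;> rfl
      · rfl
    rw [this]
    exact ⟨k, c, hi, hk, hc, rfl, Nat.zero_le _⟩

theorem fst_tail_of_lt {i k c : ℕ} {hi : i < D.n} {hk : k ≤ D.height i} {hc : c ≤ k % 2}
    (h : k < D.height i) : fst (.tail i k c hi hk hc) = Vertex.inner (D := D) ⟨i, k + 1, hi, h⟩ :=
  dif_pos h

theorem fst_tail_last {i c : ℕ} {hi : i < D.n} {hk : D.height i ≤ D.height i}
    {hc : c ≤ D.height i % 2} :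
    fst (.tail i (D.height i) c hi hk hc) = Vertex.leaf (D := D) i c hi hc := by
  simp only [fst, lt_irrefl, dif_neg, not_false_eq_true, Vertex.leaf.injEq, true_and]
  split_ifs <;> omega

variable (hz : StrictMono z) (p : D.Inner ≃ Fin t)
    (hp : ∀ (e : D.Edge) x y, src e = .inner x → tgt e = .inner y → p x < p y)

theorem cover_isLeaf_iff (v : D.Vertex) :
    (cover hz p hp).C.IsLeaf v ↔ ∀ x, v ≠ .inner x := by
  refine (curve_isLeaf_iff (fun e x y hx hy => hz (hp e x y hx hy)) v).trans ?_
  constructor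
  · rintro h x rfl
    simp at h
  · intro h
    rcases v with x | b | ⟨i, c, hi, hc⟩
    · exact absurd rfl (h x)
    · cases b <;> simp <;> omega
    · simp; omega

theorem cover_isInner_iff (v : D.Vertex) :
    (cover hz p hp).C.IsInner v ↔ ∃ x, v = .inner x :=
  curve_isInner_iff (fun e x y hx hy => hz (hp e x y hx hy)) v

theorem cover_incident_iff (e : D.Edge) (v : D.Vertex) :
    (cover hz p hp).C.Incident e v ↔ fst e = v ∨ snd e = v :=
  incident_iff e v

theorem cover_joins_iff (e : D.Edge) (u v : D.Vertex) :
    (cover hz p hp).C.Joins e u v ↔ s(fst e, snd e) = s(u, v) := by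
  rw [← joins_fst_snd]
  exact Iff.rfl

theorem cover_isEnd_iff (e : D.Edge) : (cover hz p hp).C.IsEnd e ↔
    (∀ x, fst e ≠ .inner x) ∨ ∀ x, snd e ≠ .inner x := by
  rw [← cover_isLeaf_iff hz p hp, ← cover_isLeaf_iff hz p hp]
  change _ ∨ (cover hz p hp).C.IsLeaf (tgt e) ↔ _
  rcases src_tgt_cases e with ⟨-, h1, h2⟩ | ⟨-, h1, h2⟩ <;> rw [h2]
  · exact or_congr (by rw [← h1]; rfl) Iff.rfl
  · rw [or_comm]
    exact or_congr Iff.rfl (by rw [← h1]; rfl)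

theorem cover_isEnd_path_iff {j : ℕ} (hj : j ≤ D.n) :
    (cover hz p hp).C.IsEnd (Edge.path j hj) ↔ j = 0 ∨ j = D.n := by
  rw [cover_isEnd_iff]
  refine or_congr ?_ ?_
  · cases j <;> simp [fst]
  · simp only [snd]
    split_ifs with h
    · simp [h.ne]
    · simp; omega

theorem cover_isEnd_tail_iff {i k c : ℕ} (hi : i < D.n) (hk : k ≤ D.height i) (hc : c ≤ k % 2) :
    (cover hz p hp).C.IsEnd (Edge.tail i k c hi hk hc) ↔ k = D.height i := by
  rw [cover_isEnd_iff]
  simp only [fst, snd]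
  split_ifs with h <;> simp <;> omega

/-- Induction from the far side in steps of two levels. If `m` is the height, the tail is an even
end; if `m + 1` is, it is a fork with its stem; otherwise a cycle at level `m + 1` precedes the tail
starting at level `m + 2`. -/
theorem isTail_tailEdges {i : ℕ} (hi : i < D.n) (m : ℕ) (hm : m % 2 = 0) (hmi : m ≤ D.height i) :
    (cover hz p hp).IsTail (D.tailEdges i m) (Edge.tail i m 0 hi hmi (Nat.zero_le _))
      (Vertex.inner ⟨i, m, hi, hmi⟩) := by
  induction hd : D.height i - m using Nat.strong_induction_on generalizing m with
  | _ d ih =>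
  obtain rfl | hlt := hmi.eq_or_lt
  · have hT : D.tailEdges i (D.height i) = {Edge.tail i (D.height i) 0 hi hmi (Nat.zero_le _)} := by
      ext e
      constructor
      · rintro ⟨k, c, _, hk, hc, rfl, h⟩
        obtain rfl := le_antisymm hk h
        obtain rfl : c = 0 := by omega
        rfl
      · rintro rfl
        exact ⟨_, _, _, _, _, rfl, le_rfl⟩
    rw [hT]
    refine .evenEnd _ (Vertex.leaf i 0 hi (Nat.zero_le _)) _ ?_ ?_ ?_
    · exact (cover_isLeaf_iff hz p hp _).2 (by simp)
    · rw [cover_joins_iff, fst_tail_last]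
      rfl
    · change Even (D.tailWeight i (D.height i)).natAbs
      rw [Int.natAbs_even, tailWeight, if_pos hm]
      exact even_tailFlow hi
  have hm1 : (m + 1) % 2 = 1 := by omega
  have hpair : (cover hz p hp).weight (Edge.tail i (m + 1) 0 hi hlt (Nat.zero_le _)) =
    (cover hz p hp).weight (Edge.tail i (m + 1) 1 hi hlt hm1.ge) := rfl
  have hne : (Edge.tail i (m + 1) 0 hi hlt (Nat.zero_le _) : D.Edge) ≠
    Edge.tail i (m + 1) 1 hi hlt hm1.ge := by simp
  have hne' {c : ℕ} {hc : c ≤ (m + 1) % 2} : (Edge.tail i m 0 hi hmi (Nat.zero_le _) : D.Edge) ≠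
    Edge.tail i (m + 1) c hi hlt hc := by simp
  have hjoin : (cover hz p hp).C.Joins (Edge.tail i m 0 hi hmi (Nat.zero_le _))
      (Vertex.inner ⟨i, m + 1, hi, hlt⟩) (Vertex.inner ⟨i, m, hi, hmi⟩) := by
    rw [cover_joins_iff, fst_tail_of_lt hlt]
    rfl
  rcases (Nat.succ_le_of_lt hlt).eq_or_lt with h | hlt2
  · have hT : D.tailEdges i m = {Edge.tail i (m + 1) 0 hi hlt (Nat.zero_le _),
        Edge.tail i (m + 1) 1 hi hlt hm1.ge, Edge.tail i m 0 hi hmi (Nat.zero_le _)} := by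
      ext e
      constructor
      · rintro ⟨k, c, _, hk, hc, rfl, h⟩
        simp only [Set.mem_insert_iff, Set.mem_singleton_iff, Edge.tail.injEq, true_and]
        omega
      · rintro (rfl | rfl | rfl) <;> exact ⟨_, _, _, _, _, rfl, by omega⟩
    rw [hT]
    refine .fork _ _ _ (Vertex.inner ⟨i, m + 1, hi, hlt⟩) _
      ⟨_, _, hne, rfl, hpair, ?_, ?_, Vertex.inner ⟨i, m + 1, hi, hlt⟩, ?_, ?_, ?_⟩ ?_ ?_ ?_ hjoin
      hne' hne'
    · exact (cover_isEnd_tail_iff hz p hp _ _ _).2 h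
    · exact (cover_isEnd_tail_iff hz p hp _ _ _).2 h
    · exact (cover_isInner_iff hz p hp _).2 ⟨_, rfl⟩
    · exact (cover_incident_iff hz p hp _ _).2 (Or.inr rfl)
    · exact (cover_incident_iff hz p hp _ _).2 (Or.inr rfl)
    · exact (cover_isInner_iff hz p hp _).2 ⟨_, rfl⟩
    · exact (cover_incident_iff hz p hp _ _).2 (Or.inr rfl)
    · exact (cover_incident_iff hz p hp _ _).2 (Or.inr rfl)
  · have hT : D.tailEdges i m = D.tailEdges i (m + 2) ∪ {Edge.tail i (m + 1) 0 hi hlt (Nat.zero_le _),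
        Edge.tail i (m + 1) 1 hi hlt hm1.ge, Edge.tail i m 0 hi hmi (Nat.zero_le _)} := by
      ext e
      constructor
      · rintro ⟨k, c, _, hk, hc, rfl, h⟩
        by_cases hk2 : m + 2 ≤ k
        · exact Or.inl ⟨_, _, _, _, _, rfl, hk2⟩
        · right
          simp only [Set.mem_insert_iff, Set.mem_singleton_iff, Edge.tail.injEq, true_and]
          omega
      · rintro (⟨k, c, _, hk, hc, rfl, h⟩ | rfl | rfl | rfl) <;>
          exact ⟨_, _, _, _, _, rfl, by omega⟩
    rw [hT]
    refine .cycle _ _ _ (ih _ (by omega) (m + 2) (by omega) hlt2 rfl) _ _ _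
      (Vertex.inner ⟨i, m + 1, hi, hlt⟩) _ ⟨_, _, hne, rfl, hpair, ?_, ?_, ?_, ?_⟩ ?_ ?_ ?_ hjoin ?_
    · exact fun h => by have := (cover_isEnd_tail_iff hz p hp _ _ _).1 h; omega
    · exact fun h => by have := (cover_isEnd_tail_iff hz p hp _ _ _).1 h; omega
    · change src _ = src _
      simp only [src, signed, fst, hlt2, dif_pos, snd]
    · change tgt _ = tgt _
      simp only [tgt, signed, fst, hlt2, dif_pos, snd]
    · change Odd (D.tailWeight i (m + 1)).natAbs
      rw [Int.natAbs_odd, tailWeight, if_neg (by omega)]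
      exact D.odd_half i hi (by omega)
    · rw [cover_joins_iff, fst_tail_of_lt hlt2]
      rfl
    · rw [cover_joins_iff, fst_tail_of_lt hlt2]
      rfl
    · rintro (⟨k, c, _, hk, hc, h, h'⟩ | h)
      · simp only [Edge.tail.injEq, true_and] at h
        omega
      · rcases h with h | h
        · exact hne' h
        · exact hne' h

/-- The path as a subgraph. -/
def spine : (cover hz p hp).C.Subgraph where
  verts := {v | IsSpine v}
  edges := {e | IsPath e}
  src_mem e he := by
    change IsSpine (src e)
    unfold src
    split_ifs
    exacts [(isSpine_fst_snd he).1, (isSpine_fst_snd he).2]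
  tgt_mem e he := by
    change IsSpine (tgt e)
    unfold tgt
    split_ifs
    exacts [(isSpine_fst_snd he).2, (isSpine_fst_snd he).1]

theorem spine_connected : (spine hz p hp).Connected := by
  set G := SimpleGraph.fromRel fun u v : (spine hz p hp).verts =>
    ∃ e ∈ (spine hz p hp).edges, (cover hz p hp).C.src e = u ∧ (cover hz p hp).C.tgt e = v
  have hr (e : D.Edge) (he : IsPath e) : G.Reachable ⟨snd e, (isSpine_fst_snd he).2⟩
      ⟨fst e, (isSpine_fst_snd he).1⟩ := by
    rcases src_tgt_cases e with ⟨-, h1, h2⟩ | ⟨-, h1, h2⟩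
    · exact (SimpleGraph.fromRel_reachable ⟨e, he, h1, h2⟩).symm
    · exact SimpleGraph.fromRel_reachable ⟨e, he, h1, h2⟩
  have h0 : ∀ i (hi : i < D.n), G.Reachable ⟨Vertex.inner ⟨0, 0, n_pos, Nat.zero_le _⟩, rfl⟩
      ⟨Vertex.inner ⟨i, 0, hi, Nat.zero_le _⟩, rfl⟩ := by
    intro i
    induction i with
    | zero => exact fun _ => .refl _
    | succ i ih =>
      intro hi
      have := hr (.path (i + 1) hi.le) trivial
      simp only [snd, fst, hi, dif_pos] at this
      exact (ih _).trans this.symm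
  have : Nonempty (spine hz p hp).verts := ⟨⟨Vertex.pathEnd true, trivial⟩⟩
  refine SimpleGraph.connected_iff_exists_forall_reachable _ |>.2
    ⟨⟨Vertex.inner ⟨0, 0, n_pos, Nat.zero_le _⟩, rfl⟩, ?_⟩
  rintro ⟨v, hv⟩
  change IsSpine v at hv
  rcases v with ⟨i, k, hi, hk⟩ | b | ⟨i, c, hi, hc⟩
  · obtain rfl : k = 0 := hv
    exact h0 i hi
  · cases b
    · have := hr (.path 0 (Nat.zero_le _)) trivial
      simp only [snd, fst, n_pos, dif_pos] at this
      exact this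
    · have := hr (.path D.n le_rfl) trivial
      simp only [fst_path_of_pos _ n_pos] at this
      simp only [snd, lt_irrefl, dif_neg, not_false_eq_true] at this
      exact (h0 _ _).trans this.symm
  · exact hv.elim

/-- All edges at a vertex off the path belong to the tail of that vertex, so the component stays in
one tail. Conversely, consecutive levels of a tail share a vertex off the path. -/
theorem componentOf_spine {i k c : ℕ} (hi : i < D.n) (hk : k ≤ D.height i) (hc : c ≤ k % 2) :
    (spine hz p hp).componentOf (Edge.tail i k c hi hk hc) = D.tailEdges i 0 := by
  set r : D.Edge → D.Edge → Prop := fun a b => ∃ v, v ∉ (spine hz p hp).verts ∧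
    (cover hz p hp).C.Incident a v ∧ (cover hz p hp).C.Incident b v
  have hsymm : Std.Symm (Relation.ReflTransGen r) :=
    haveI : Std.Symm r := ⟨fun a b ⟨v, h1, h2, h3⟩ => ⟨v, h1, h3, h2⟩⟩
    Relation.ReflTransGen.stdSymm
  have hup : ∀ k (hk : k ≤ D.height i) c (hc : c ≤ k % 2),
      Relation.ReflTransGen r (Edge.tail i 0 0 hi (Nat.zero_le _) le_rfl)
        (Edge.tail i k c hi hk hc) := by
    intro k
    induction k with
    | zero =>
      intro hk c hc
      obtain rfl : c = 0 := by omega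
      exact .refl
    | succ k ih =>
      intro hk c hc
      refine (ih (Nat.le_of_succ_le hk) 0 (Nat.zero_le _)).tail
        ⟨Vertex.inner ⟨i, k + 1, hi, hk⟩, fun h => absurd h (Nat.succ_ne_zero k), ?_, ?_⟩
      · exact (cover_incident_iff hz p hp _ _).2 (Or.inl (fst_tail_of_lt hk))
      · exact (cover_incident_iff hz p hp _ _).2 (Or.inr rfl)
  ext e
  constructor
  · intro h
    change Relation.ReflTransGen r _ e at h
    induction h with
    | refl => exact ⟨_, _, _, _, _, rfl, Nat.zero_le _⟩
    | tail _ h ih =>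
      obtain ⟨v, hv, h1, h2⟩ := h
      have h1' := mem_tailEdges_of_incident hv h1
      obtain ⟨_, _, _, _, _, rfl, -⟩ := ih
      obtain ⟨_, _, _, _, _, heq, -⟩ := h1'
      rw [(Edge.tail.inj heq).1]
      exact mem_tailEdges_of_incident hv h2
  · rintro ⟨k', c', _, hk', hc', rfl, -⟩
    exact (hsymm.symm _ _ (hup k hk c hc)).trans (hup k' hk' c' hc')

/-- Excludes path edges from symmetric cycles: consecutive vertices of the path are joined by one
edge only. -/
theorem eq_path_of_src_eq {j : ℕ} (hj : j ≤ D.n) (hj0 : 0 < j) (hjn : j < D.n) {f : D.Edge}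
    (hs : src f = src (.path j hj)) (ht : tgt f = tgt (.path j hj)) : f = .path j hj := by
  have h := joins_fst_snd f
  rw [hs, ht, joins_fst_snd, Sym2.eq_iff, fst_path_of_pos hj hj0] at h
  simp only [snd, hjn, dif_pos] at h
  rcases f with ⟨j', hj'⟩ | ⟨i, k, c, hi, hk, hc⟩
  · rcases j' with _ | j'
    · simp [fst] at h
    · simp only [fst] at h
      split_ifs at h
      · simp at h ⊢; omega
      · simp at h
  · simp only [fst] at h
    split_ifs at h <;> simp at h

theorem odd_weight_path {j : ℕ} (hj : j ≤ D.n) : Odd (weight (.path j hj : D.Edge)) :=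
  Int.natAbs_odd.2 (D.odd_flow j hj)

/-- The partner in such a fork would be the other end of the path, which is at a different vertex as
`2 ≤ n`, or a tail of height 0, whose weight is even whereas that of the path edge is odd. -/
theorem not_fork_path {j : ℕ} (hj : j ≤ D.n) {f : D.Edge} (hne : f ≠ .path j hj)
    (hw : weight f = weight (.path j hj : D.Edge)) (he : (cover hz p hp).C.IsEnd (Edge.path j hj))
    (hf : (cover hz p hp).C.IsEnd f) {x : D.Inner} (hx : fst (.path j hj) = .inner x ∨
      snd (.path j hj) = .inner x) (hx' : fst f = .inner x ∨ snd f = .inner x) : False := by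
  have hn := D.two_le
  have key {j : ℕ} (hj : j ≤ D.n) (he : (cover hz p hp).C.IsEnd (Edge.path j hj))
      (hx : fst (.path j hj) = .inner x ∨ snd (.path j hj) = .inner x) :
      x.k = 0 ∧ (j = 0 ∧ x.i = 0 ∨ j = D.n ∧ x.i + 1 = D.n) := by
    rcases (cover_isEnd_path_iff hz p hp hj).1 he with rfl | rfl
    · simp only [fst, snd, n_pos, dif_pos, reduceCtorEq, false_or, Vertex.inner.injEq] at hx
      subst hx
      simp
    · rw [fst_path_of_pos _ n_pos] at hx
      simp only [snd, lt_irrefl, dif_neg, not_false_eq_true, reduceCtorEq, or_false,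
        Vertex.inner.injEq] at hx
      subst hx
      exact ⟨rfl, Or.inr ⟨rfl, by simp only; omega⟩⟩
  have h1 := key hj he hx
  rcases f with ⟨j', hj'⟩ | ⟨i, k, c, hi, hk, hc⟩
  · have h2 := key hj' hf hx'
    have : j' ≠ j := fun h => hne (by subst h; rfl)
    omega
  · obtain rfl := (cover_isEnd_tail_iff hz p hp _ _ _).1 hf
    rw [fst_tail_last] at hx'
    simp only [snd, reduceCtorEq, false_or, Vertex.inner.injEq] at hx'
    subst hx'
    have h0 : D.height i = 0 := h1.1
    have hodd := odd_weight_path hj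
    rw [← hw] at hodd
    change Odd (D.tailWeight i (D.height i)).natAbs at hodd
    rw [Int.natAbs_odd, tailWeight, h0, if_pos rfl, ← Int.not_even_iff_odd] at hodd
    exact hodd (even_tailFlow hi)

theorem cover_isZigzag : (cover hz p hp).IsZigzag := by
  refine ⟨spine hz p hp, spine_connected hz p hp, ?_, ?_, ?_, ?_⟩
  · intro e he P hP heP
    change D.Edge at e
    rcases e with ⟨j, hj⟩ | _
    swap; · exact he
    rcases hP with ⟨e, f, hne, rfl, hw, h1, h2, h3, h4⟩ | ⟨e, f, hne, rfl, hw, h1, h2, v, hv, h3, h4⟩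
    · rcases heP with rfl | rfl
      · have := (cover_isEnd_path_iff hz p hp hj).not.1 h1
        exact hne (eq_path_of_src_eq hj (by omega) (by omega) h3.symm h4.symm).symm
      · have := (cover_isEnd_path_iff hz p hp hj).not.1 h2
        exact hne (eq_path_of_src_eq hj (by omega) (by omega) h3 h4)
    · obtain ⟨x, rfl⟩ := (cover_isInner_iff hz p hp v).1 hv
      rcases heP with rfl | rfl
      · exact not_fork_path hz p hp hj (f := f) hne.symm hw.symm h1 h2
          ((incident_iff _ _).1 h3) ((incident_iff _ _).1 h4)
      · exact not_fork_path hz p hp hj (f := e) hne hw h2 h1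
          ((incident_iff _ _).1 h4) ((incident_iff _ _).1 h3)
  · exact ⟨Vertex.inner ⟨0, 0, n_pos, Nat.zero_le _⟩, rfl, (cover_isInner_iff hz p hp _).2 ⟨_, rfl⟩⟩
  · intro e he
    change D.Edge at e
    rcases e with ⟨j, hj⟩ | _
    · exact Nat.not_even_iff_odd.2 (odd_weight_path hj)
    · exact he.elim
  · intro e he
    change D.Edge at e
    rcases e with ⟨j, hj⟩ | ⟨i, k, c, hi, hk, hc⟩
    · exact absurd trivial he
    · rw [componentOf_spine]
      exact ⟨_, _, rfl, isTail_tailEdges hz p hp hi 0 rfl (Nat.zero_le _)⟩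

end ZigzagData

/-! ### Orderings by level and fibre-preserving permutations -/

theorem exists_equiv_fin_of_level {α : Type*} [Fintype α] (L : α → ℤ) {t : ℕ}
    (h : Fintype.card α = t) : ∃ p : α ≃ Fin t, ∀ x y, L x < L y → p x < p y := by
  subst h
  let e := Fintype.equivFin α
  -- The sorting permutation lists the elements by increasing level; its inverse assigns ranks.
  let s := Tuple.sort (L ∘ e.symm)
  refine ⟨e.trans s.symm, fun x y hxy => ?_⟩
  by_contra hle
  have := Tuple.monotone_sort (L ∘ e.symm) (not_lt.1 hle)
  simp [s] at this
  exact absurd hxy (not_lt.2 this)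

open scoped Classical Nat in
/-- Permutations of the fibres of `f` over `T` preserve `f`. -/
theorem prod_factorial_le_card_perm {α ι : Type*} [Fintype α] (f : α → ι) (T : Finset ι)
    (c : ι → ℕ) (hc : ∀ i ∈ T, c i ≤ Nat.card {a // f a = i}) :
    ∏ i ∈ T, (c i)! ≤ Fintype.card {g : Equiv.Perm α // f ∘ g = f} := by
  rw [DomMulAct.stabilizer_card']
  calc ∏ i ∈ T, (c i)! ≤ ∏ i ∈ T, (Fintype.card {a // f a = i})! :=
        Finset.prod_le_prod' fun i hi => Nat.factorial_le ((hc i hi).trans Nat.card_eq_fintype_card.le)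
    -- Indices outside the image have empty fibres and contribute 0! = 1.
    _ = ∏ i ∈ T ∩ Finset.univ.image f, (Fintype.card {a // f a = i})! := by
        refine (Finset.prod_subset Finset.inter_subset_left fun i hi hi' => ?_).symm
        have : IsEmpty {a // f a = i} := ⟨fun a => hi' (Finset.mem_inter.2
          ⟨hi, Finset.mem_image.2 ⟨a, Finset.mem_univ _, a.2⟩⟩)⟩
        simp
    _ ≤ _ := Finset.prod_le_prod_of_subset_of_one_le' Finset.inter_subset_right
        fun i _ _ => Nat.succ_le_of_lt (Nat.factorial_pos _)

/-! ### Counting non-isomorphic orderings -/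

namespace ZigzagData

open scoped Classical Nat

variable {D : ZigzagData}

/-- The height of the vertices of the path when each edge has height one. -/
def pathLevel (D : ZigzagData) : ℕ → ℤ
  | 0 => 0
  | j + 1 => D.pathLevel j + (D.flow (j + 1)).sign

/-- The height of the inner vertices when each edge has height one. -/
def level (x : D.Inner) : ℤ := D.pathLevel x.i - x.k * (D.tailFlow x.i).sign

theorem level_lt (e : D.Edge) (x y : D.Inner) (hx : src e = .inner x) (hy : tgt e = .inner y) :
    level x < level y := by
  rcases e with ⟨j, hj⟩ | ⟨i, k, c, hi, hk, hc⟩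
  · have h0 := flow_ne_zero hj
    rcases j with _ | j
    · rcases src_tgt_cases (.path 0 hj) with ⟨h, h1, h2⟩ | ⟨h, h1, h2⟩
      · simp [h1, fst] at hx
      · simp [h2, fst] at hy
    · rcases hj.lt_or_eq with hj' | hj'
      swap
      · rcases src_tgt_cases (.path (j + 1) hj) with ⟨h, h1, h2⟩ | ⟨h, h1, h2⟩
        · rw [h2] at hy; simp [snd, hj'] at hy
        · rw [h1] at hx; simp [snd, hj'] at hx
      rcases src_tgt_cases (.path (j + 1) hj) with ⟨h, h1, h2⟩ | ⟨h, h1, h2⟩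
      · simp only [h1, h2, fst, snd, hj', dif_pos, Vertex.inner.injEq] at hx hy
        subst hx hy
        simp only [signed] at h
        simp [level, pathLevel, Int.sign_eq_one_of_pos h]
      · simp only [h1, h2, fst, snd, hj', dif_pos, Vertex.inner.injEq] at hx hy
        subst hx hy
        simp only [signed] at h
        simp [level, pathLevel, Int.sign_eq_neg_one_of_neg (lt_of_le_of_ne (not_lt.1 h) h0)]
  · have h0 := tailFlow_ne hi
    rcases hk.lt_or_eq with hk' | hk'
    swap
    · subst hk'
      rcases src_tgt_cases (.tail i _ c hi hk hc) with ⟨h, h1, h2⟩ | ⟨h, h1, h2⟩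
      · rw [h1, fst_tail_last] at hx; cases hx
      · rw [h2, fst_tail_last] at hy; cases hy
    rcases src_tgt_cases (.tail i k c hi hk hc) with ⟨h, h1, h2⟩ | ⟨h, h1, h2⟩
    · simp only [h1, h2, fst, snd, hk', dif_pos, Vertex.inner.injEq] at hx hy
      subst hx hy
      simp only [signed, tailWeight_pos_iff hi] at h
      simp [level, Int.sign_eq_one_of_pos h]
    · simp only [h1, h2, fst, snd, hk', dif_pos, Vertex.inner.injEq] at hx hy
      subst hx hy
      simp only [signed, tailWeight_pos_iff hi] at h
      simp [level, Int.sign_eq_neg_one_of_neg (lt_of_le_of_ne (not_lt.1 h) h0)]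
      omega

/-- Adjacency of inner vertices. -/
def Adj (x y : D.Inner) : Prop :=
  ∃ e : D.Edge, s(src e, tgt e) = s(Vertex.inner x, Vertex.inner y)

theorem adj_path {x y : D.Inner} (hx : x.k = 0) (hy : y.k = 0) (h : y.i = x.i + 1) : Adj x y := by
  obtain ⟨i, k, hi, hk⟩ := x
  obtain ⟨i', k', hi', hk'⟩ := y
  simp only at hx hy h
  subst hx hy h
  refine ⟨.path (i + 1) hi'.le, ?_⟩
  rw [joins_fst_snd]
  simp [fst, snd, hi']

theorem adj_tail {x y : D.Inner} (hi : x.i = y.i) (h : x.k = y.k + 1) : Adj x y := by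
  obtain ⟨i, k, hi, hk⟩ := x
  obtain ⟨i', k', hi', hk'⟩ := y
  simp only at hi h
  subst hi h
  refine ⟨.tail i k' 0 hi hk' (Nat.zero_le _), ?_⟩
  rw [joins_fst_snd, fst_tail_of_lt hk]
  rfl

theorem Adj.cases {x y : D.Inner} (h : Adj x y) :
    x.i = y.i ∧ (x.k = y.k + 1 ∨ y.k = x.k + 1) ∨
      x.k = 0 ∧ y.k = 0 ∧ (x.i = y.i + 1 ∨ y.i = x.i + 1) := by
  obtain ⟨e, he⟩ := h
  rw [joins_fst_snd, Sym2.eq_iff] at he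
  rcases e with ⟨j, hj⟩ | ⟨i, k, c, hi, hk, hc⟩
  · right
    rcases j with _ | j
    · simp [fst] at he
    · simp only [fst, snd] at he
      split_ifs at he
      · simp only [Vertex.inner.injEq] at he
        rcases he with ⟨rfl, rfl⟩ | ⟨rfl, rfl⟩ <;> simp
      · simp at he
  · left
    simp only [fst, snd] at he
    split_ifs at he
    · simp only [Vertex.inner.injEq] at he
      rcases he with ⟨rfl, rfl⟩ | ⟨rfl, rfl⟩ <;> simp
    all_goals simp at he

/-- Each branch point has exactly one inner vertex above it in either cover, so on inner vertices
the isomorphism must be the map `p'.symm ∘ p`. -/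
theorem adj_of_isomorphic {t : ℕ} {z : Fin t → ℝ} (hz : StrictMono z) {p p' : D.Inner ≃ Fin t}
    (hp : ∀ (e : D.Edge) x y, src e = .inner x → tgt e = .inner y → p x < p y)
    (hp' : ∀ (e : D.Edge) x y, src e = .inner x → tgt e = .inner y → p' x < p' y)
    (h : (cover hz p hp).Isomorphic (cover hz p' hp')) {x y : D.Inner} (hxy : Adj x y) :
    Adj (p'.symm (p x)) (p'.symm (p y)) := by
  obtain ⟨a, b, hs, ht, -, hpos, -⟩ := h
  have ha (x : D.Inner) : a (Vertex.inner x) = Vertex.inner (p'.symm (p x)) := by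
    have h1 : pos (fun x => z (p' x)) (a (Vertex.inner x)) = ((z (p x) : ℝ) : EReal) :=
      hpos (Vertex.inner x)
    generalize a (Vertex.inner x) = v at h1 ⊢
    change D.Vertex at v
    rcases v with y | c | ⟨i, c, hi, hc⟩
    · have h2 : z (p' y) = z (p x) := EReal.coe_injective h1
      have h3 := hz.injective h2
      rw [← h3, Equiv.symm_apply_apply]
    · simp only [pos] at h1
      split_ifs at h1
      · exact absurd h1.symm (EReal.coe_ne_bot _)
      · exact absurd h1.symm (EReal.coe_ne_top _)
    · simp only [pos] at h1
      split_ifs at h1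
      · exact absurd h1.symm (EReal.coe_ne_bot _)
      · exact absurd h1.symm (EReal.coe_ne_top _)
  obtain ⟨e, he⟩ := hxy
  refine ⟨b e, ?_⟩
  have h1 : src (D := D) (b e) = a (src e) := hs e
  have h2 : tgt (D := D) (b e) = a (tgt e) := ht e
  rw [h1, h2, ← ha, ← ha]
  exact congrArg (Sym2.map a) he

/-- If the permutations of the inner vertices preserving `f` preserve levels, and the identity is
the only automorphism among them, then they give pairwise non-isomorphic zigzag covers. -/
theorem card_perm_le_zigzagNumber {g t : ℕ} {lam mu : Multiset ℕ} {z : Fin t → ℝ}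
    (hz : StrictMono z) (ht : Fintype.card D.Inner = t)
    (hg : ∑ i ∈ Finset.range D.n, D.height i / 2 = g) (hlam : D.leftEnds = lam)
    (hmu : D.rightEnds = mu) {ι : Type*} (f : D.Inner → ι)
    (hf : ∀ x y, f x = f y → level x = level y)
    (hrigid : ∀ r : Equiv.Perm D.Inner, f ∘ r = f → (∀ x y, Adj x y → Adj (r x) (r y)) → r = 1) :
    Fintype.card {r : Equiv.Perm D.Inner // f ∘ r = f} ≤ zigzagNumber g lam mu z := by
  subst hg hlam hmu
  obtain ⟨p, hp⟩ := exists_equiv_fin_of_level (level (D := D)) ht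
  have hp' (r : {r : Equiv.Perm D.Inner // f ∘ r = f}) (e : D.Edge) (x y) (hx : src e = .inner x)
      (hy : tgt e = .inner y) : (r.1.trans p) x < (r.1.trans p) y := by
    refine hp _ _ ?_
    -- Since `r` preserves levels, the permuted ordering still increases along every edge.
    rw [hf _ x (congrFun r.2 x), hf _ y (congrFun r.2 y)]
    exact level_lt e x y hx hy
  let cls (r : {r : Equiv.Perm D.Inner // f ∘ r = f}) :
      ZigzagClass (∑ i ∈ Finset.range D.n, D.height i / 2) D.leftEnds D.rightEnds z :=
    Quotient.mk _ ⟨cover hz (r.1.trans p) (hp' r), cover_isZigzag hz _ _⟩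
  have hcls : Function.Injective cls := by
    intro r s hrs
    have hiso : (cover hz (r.1.trans p) (hp' r)).Isomorphic (cover hz (s.1.trans p) (hp' s)) :=
      Quotient.exact hrs
    -- On inner vertices the isomorphism is `r` followed by the inverse of `s`; it preserves `f`
    -- because both do.
    have h1 := hrigid (r.1.trans s.1.symm) (by
      funext x
      have h2 := congrFun s.2 (s.1.symm (r.1 x))
      simp only [Function.comp_apply, Equiv.apply_symm_apply] at h2
      simp only [Function.comp_apply, Equiv.trans_apply, ← h2]
      exact congrFun r.2 x) (fun x y hxy => by
        simpa using adj_of_isomorphic hz _ _ hiso hxy)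
    ext1
    ext1 x
    have := congrArg s.1 (Equiv.congr_fun h1 x)
    simpa using this
  -- With finitely many classes the `finsum` is an honest sum, each of whose terms is at least 1.
  have := Fintype.ofFinite
    (ZigzagClass (∑ i ∈ Finset.range D.n, D.height i / 2) D.leftEnds D.rightEnds z)
  unfold zigzagNumber
  rw [finsum_eq_sum_of_fintype]
  refine (Fintype.card_le_of_injective cls hcls).trans ?_
  rw [Fintype.card_eq_sum_ones]
  exact Finset.sum_le_sum fun c _ => Nat.one_le_two_pow

/-- `D` contains a zigzag: `M` vertices with left tails alternating with `M` vertices with right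
tails, starting at `a > 0`, all edges of the path having weight one there. -/
structure HasZigzag (D : ZigzagData) (a M : ℕ) : Prop where
  pos : 0 < a
  le_n : a + 2 * M ≤ D.n
  flow_even : ∀ i ≤ M, D.flow (a + 2 * i) = -1
  flow_odd : ∀ i < M, D.flow (a + 2 * i + 1) = 1

/-- The type of an inner vertex: two vertices of the same type are in corresponding positions
of tails of the zigzag. -/
def zigzagType (D : ZigzagData) (a M : ℕ) (x : D.Inner) : ℕ × ℕ :=
  if a ≤ x.i ∧ x.i < a + 2 * M then (a + (x.i - a) % 2, x.k) else (x.i, x.k)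

theorem HasZigzag.pathLevel_eq {a M : ℕ} (h : D.HasZigzag a M) (i : ℕ) :
    (i ≤ M → D.pathLevel (a + 2 * i) = D.pathLevel a) ∧
      (i < M → D.pathLevel (a + 2 * i + 1) = D.pathLevel a + 1) := by
  have h2 (i : ℕ) (hi : i < M) (h1 : D.pathLevel (a + 2 * i) = D.pathLevel a) :
      D.pathLevel (a + 2 * i + 1) = D.pathLevel a + 1 := by
    rw [pathLevel, h1, h.flow_odd i hi]
    rfl
  induction i with
  | zero => exact ⟨fun _ => rfl, fun hi => h2 0 hi rfl⟩
  | succ i ih =>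
    have h1 (hi : i + 1 ≤ M) : D.pathLevel (a + 2 * (i + 1)) = D.pathLevel a := by
      have h3 := h.flow_even (i + 1) hi
      rw [show a + 2 * (i + 1) = a + 2 * i + 1 + 1 by ring] at h3 ⊢
      rw [pathLevel, ih.2 hi, h3]
      simp
    exact ⟨h1, fun hi => h2 _ hi (h1 hi.le)⟩

/-- At even offsets from `a` the tail has signed weight 2 and descends from the lower path level; at
odd offsets it has signed weight -2 and ascends from the upper one. Only the parity of the offset
and the position in the tail matter. -/
theorem HasZigzag.level_eq {a M : ℕ} (h : D.HasZigzag a M) (x : D.Inner) (hx : a ≤ x.i)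
    (hx' : x.i < a + 2 * M) :
    level x = D.pathLevel a + ((x.i - a) % 2 : ℕ) - x.k * (1 - 2 * ((x.i - a) % 2 : ℕ)) := by
  obtain ⟨i, hi⟩ : ∃ i, (x.i - a) = 2 * i ∨ (x.i - a) = 2 * i + 1 :=
    ⟨(x.i - a) / 2, by omega⟩
  rcases hi with hi | hi
  · have hxi : x.i = a + 2 * i := by omega
    have h1 : (x.i - a) % 2 = 0 := by omega
    have h2 : D.tailFlow (a + 2 * i) = 2 := by
      rw [tailFlow, h.flow_even i (by omega), h.flow_odd i (by omega)]
      norm_num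
    rw [h1, level, hxi, (h.pathLevel_eq i).1 (by omega), h2]
    simp [show Int.sign 2 = 1 from rfl]
  · have hxi : x.i = a + 2 * i + 1 := by omega
    have h1 : (x.i - a) % 2 = 1 := by omega
    have h2 : D.tailFlow (a + 2 * i + 1) = -2 := by
      have h3 := h.flow_even (i + 1) (by omega)
      rw [tailFlow, h.flow_odd i (by omega), show a + 2 * i + 1 + 1 = a + 2 * (i + 1) by ring, h3]
      norm_num
    rw [h1, level, hxi, (h.pathLevel_eq i).2 (by omega), h2]
    simp [show Int.sign 2 = 1 from rfl]

theorem HasZigzag.level_eq_of_type_eq {a M : ℕ} (h : D.HasZigzag a M) (x y : D.Inner)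
    (hxy : D.zigzagType a M x = D.zigzagType a M y) : level x = level y := by
  unfold zigzagType at hxy
  split_ifs at hxy with h1 h2 h2
  · rw [h.level_eq x h1.1 h1.2, h.level_eq y h2.1 h2.2]
    simp only [Prod.mk.injEq] at hxy
    rw [show (x.i - a) % 2 = (y.i - a) % 2 by omega, hxy.2]
  · simp only [Prod.mk.injEq] at hxy
    omega
  · simp only [Prod.mk.injEq] at hxy
    omega
  · simp only [Prod.mk.injEq] at hxy
    rw [show x = y from Inner.ext hxy.1 hxy.2]

theorem zigzagType_eq_iff {a M : ℕ} {x y : D.Inner}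
    (h : D.zigzagType a M y = D.zigzagType a M x) :
    y.k = x.k ∧ (y.i = x.i ∨ a ≤ x.i ∧ a ≤ y.i ∧ (y.i - a) % 2 = (x.i - a) % 2) := by
  unfold zigzagType at h
  split_ifs at h <;> simp only [Prod.mk.injEq] at h <;> omega

/-- Vertex 0 of the path lies before the zigzag, as `0 < a`, so its type fixes it. From there
fixedness spreads along the path and then up each tail, since `r` preserves adjacency and the
position `k`. -/
theorem rigid {a M : ℕ} (ha : 0 < a) (r : Equiv.Perm D.Inner)
    (hr : D.zigzagType a M ∘ r = D.zigzagType a M) (hadj : ∀ x y, Adj x y → Adj (r x) (r y)) :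
    r = 1 := by
  have ht (x : D.Inner) := zigzagType_eq_iff (congrFun hr x)
  have hpath : ∀ i (hi : i < D.n), r ⟨i, 0, hi, Nat.zero_le _⟩ = ⟨i, 0, hi, Nat.zero_le _⟩ := by
    intro i
    induction i using Nat.strong_induction_on with
    | _ i ih =>
    intro hi
    have h1 := ht ⟨i, 0, hi, Nat.zero_le _⟩
    simp only at h1
    by_cases hia : (r ⟨i, 0, hi, Nat.zero_le _⟩).i = i
    · exact Inner.ext hia h1.1
    have h2 := hadj ⟨i - 1, 0, by omega, Nat.zero_le _⟩ ⟨i, 0, hi, Nat.zero_le _⟩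
      (adj_path rfl rfl (by simp only; omega))
    rw [ih (i - 1) (by omega)] at h2
    have h3 := h2.cases
    simp only at h3
    -- The only other path neighbour of the fixed vertex `i - 1` is `i - 2`, which is already its
    -- own image, contradicting injectivity.
    have h4 : (r ⟨i, 0, hi, Nat.zero_le _⟩).i = i - 2 := by omega
    have h5 : r ⟨i, 0, hi, Nat.zero_le _⟩ = r ⟨i - 2, 0, by omega, Nat.zero_le _⟩ := by
      rw [ih (i - 2) (by omega)]
      exact Inner.ext h4 h1.1
    have h6 := congrArg Inner.i (r.injective h5)
    simp only at h6
    omega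
  have htail : ∀ k i (hi : i < D.n) (hk : k ≤ D.height i), r ⟨i, k, hi, hk⟩ = ⟨i, k, hi, hk⟩ := by
    intro k
    induction k with
    | zero => exact fun i hi _ => hpath i hi
    | succ k ih =>
      intro i hi hk
      have h1 := ht ⟨i, k + 1, hi, hk⟩
      have h2 := hadj ⟨i, k + 1, hi, hk⟩ ⟨i, k, hi, Nat.le_of_succ_le hk⟩ (adj_tail rfl rfl)
      rw [ih] at h2
      have h3 := h2.cases
      simp only at h1 h3
      exact Inner.ext (by simp only; omega) h1.1
  exact Equiv.ext fun x => htail _ _ _ _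

theorem HasZigzag.le_card_type {a M : ℕ} (h : D.HasZigzag a M) {b k c : ℕ} (hb : b < 2) (hc : c ≤ M)
    (hk : ∀ i < c, k ≤ D.height (a + 2 * i + b)) :
    c ≤ Nat.card {x : D.Inner // D.zigzagType a M x = (a + b, k)} := by
  have hn := h.le_n
  rw [Nat.card_eq_fintype_card, ← Fintype.card_fin c]
  refine Fintype.card_le_of_injective (fun i => ⟨⟨a + 2 * i + b, k, by omega, hk i i.2⟩, ?_⟩) ?_
  · have := i.2
    rw [zigzagType, if_pos (by simp only; omega)]
    simp only [Prod.mk.injEq, and_true]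
    omega
  · intro i j hij
    simp only [Subtype.mk.injEq, Inner.mk.injEq] at hij
    ext
    omega

/-- Positions 0, …, 2q+1 occur in all M left tails and positions 0, 1 in all M right tails, which
gives 2q+4 factors M!. Positions 2q+2 and 2q+3 occur in at least s left tails, which gives two
factors s!. -/
theorem HasZigzag.factorial_le_zigzagNumber {a M : ℕ} (h : D.HasZigzag a M) {g t q s : ℕ}
    {lam mu : Multiset ℕ} {z : Fin t → ℝ} (hz : StrictMono z) (ht : Fintype.card D.Inner = t)
    (hg : ∑ i ∈ Finset.range D.n, D.height i / 2 = g) (hlam : D.leftEnds = lam)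
    (hmu : D.rightEnds = mu) (hs : s ≤ M) (h1 : ∀ i < M, 2 * q + 1 ≤ D.height (a + 2 * i))
    (h2 : ∀ i < s, 2 * q + 3 ≤ D.height (a + 2 * i))
    (h3 : ∀ i < M, 1 ≤ D.height (a + 2 * i + 1)) :
    M ! ^ (2 * q + 4) * s ! ^ 2 ≤ zigzagNumber g lam mu z := by
  refine le_trans ?_ (card_perm_le_zigzagNumber hz ht hg hlam hmu (D.zigzagType a M)
    h.level_eq_of_type_eq fun r hr hadj => rigid h.pos r hr hadj)
  set T : Finset (ℕ × ℕ) := {a} ×ˢ Finset.range (2 * q + 4) ∪ {a + 1} ×ˢ Finset.range 2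
  let c : ℕ × ℕ → ℕ := fun i => if i.1 = a ∧ 2 * q + 2 ≤ i.2 then s else M
  refine le_trans (le_of_eq ?_) (prod_factorial_le_card_perm _ T c ?_)
  · rw [Finset.prod_union (by
      rw [Finset.disjoint_left]
      rintro ⟨i, k⟩
      simp only [Finset.mem_product, Finset.mem_singleton]
      omega), Finset.prod_product, Finset.prod_product, Finset.prod_singleton,
      Finset.prod_singleton, Finset.prod_range_succ, Finset.prod_range_succ,
      Finset.prod_congr rfl (g := fun _ => M !)]
    · simp [c]
      ring
    · intro k hk
      have := Finset.mem_range.1 hk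
      simp only [c]
      rw [if_neg (by omega)]
  · rintro ⟨i, k⟩ hik
    simp only [T, Finset.mem_union, Finset.mem_product, Finset.mem_singleton,
      Finset.mem_range] at hik
    rcases hik with ⟨rfl, hk⟩ | ⟨rfl, hk⟩
    · by_cases hk2 : 2 * q + 2 ≤ k
      · simp only [c, hk2, and_true, if_true]
        exact h.le_card_type (b := 0) (by norm_num) hs fun i hi => (by omega : k ≤ _).trans (h2 i hi)
      · simp only [c, hk2, and_false, if_false]
        exact h.le_card_type (b := 0) (by norm_num) le_rfl
          fun i hi => (by omega : k ≤ _).trans (h1 i hi)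
    · simp only [c, Nat.add_eq_left, one_ne_zero, false_and, if_false]
      exact h.le_card_type (b := 1) (by norm_num) le_rfl
        fun i hi => (by omega : k ≤ _).trans (h3 i hi)

end ZigzagData

/-! ### Constructing data with prescribed ends and genus -/

namespace ZigzagData

theorem card_leftEnds_add_card_rightEnds (D : ZigzagData) :
    Multiset.card D.leftEnds + Multiset.card D.rightEnds =
      2 + ∑ i ∈ Finset.range D.n, (D.height i % 2 + 1) := by
  have h0 := flow_ne_zero (Nat.zero_le D.n)
  have hn := flow_ne_zero (le_refl D.n)
  have h1 : ∑ i ∈ Finset.range D.n, (D.height i % 2 + 1) =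
      ∑ i ∈ Finset.range D.n, Multiset.card (if 0 < D.tailFlow i then D.tailEnds i else 0) +
        ∑ i ∈ Finset.range D.n, Multiset.card (if D.tailFlow i < 0 then D.tailEnds i else 0) := by
    rw [← Finset.sum_add_distrib]
    refine Finset.sum_congr rfl fun i hi => ?_
    have := tailFlow_ne (Finset.mem_range.1 hi)
    rcases lt_or_gt_of_ne this with h | h <;> simp [h, h.le, tailEnds]
  rw [h1]
  unfold leftEnds rightEnds
  simp only [Multiset.card_add, Multiset.card_sum]
  rcases lt_or_gt_of_ne h0 with h0 | h0 <;> rcases lt_or_gt_of_ne hn with hn | hn <;>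
    simp [h0, hn, h0.not_gt, hn.not_gt] <;> ring

/-- The Riemann–Hurwitz count of branch points, which makes the inner vertices match the index type
of `z`. -/
theorem card_inner_add_two (D : ZigzagData) : Fintype.card D.Inner + 2 =
    Multiset.card D.leftEnds + Multiset.card D.rightEnds +
      2 * ∑ i ∈ Finset.range D.n, D.height i / 2 := by
  rw [card_leftEnds_add_card_rightEnds, card_inner, Finset.mul_sum, add_assoc,
    ← Finset.sum_add_distrib, add_comm]
  congr 1
  exact Finset.sum_congr rfl fun i _ => by omega

/-- A tail is given by the signed weight of its last edge and its height. -/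
def IsTailDatum (x : ℤ × ℕ) : Prop := x.1 ≠ 0 ∧ Even x.1 ∧ (2 ≤ x.2 → Odd (x.1 / 2))

/-- The weights of the ends of a tail. -/
def ends (x : ℤ × ℕ) : Multiset ℕ :=
  Multiset.replicate (x.2 % 2 + 1) (if x.2 % 2 = 0 then x.1 else x.1 / 2).natAbs

def lowerEnds (l : List (ℤ × ℕ)) : Multiset ℕ := (l.map fun x => if 0 < x.1 then ends x else 0).sum

def upperEnds (l : List (ℤ × ℕ)) : Multiset ℕ := (l.map fun x => if x.1 < 0 then ends x else 0).sum

theorem sum_range_getD {α M : Type*} [AddCommMonoid M] (l : List α) (d : α) (f : α → M) :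
    ∑ i ∈ Finset.range l.length, f (l.getD i d) = (l.map f).sum := by
  induction l with
  | nil => simp
  | cons x l ih =>
    rw [List.length_cons, Finset.sum_range_succ', List.map_cons, List.sum_cons, ← ih, add_comm]
    simp

theorem sum_take_succ_getD (l : List (ℤ × ℕ)) (j : ℕ) :
    ((l.take (j + 1)).map Prod.fst).sum =
      ((l.take j).map Prod.fst).sum + (l.getD j (0, 0)).1 := by
  induction l generalizing j with
  | nil => simp
  | cons x l ih =>
    cases j with
    | zero => simp
    | succ j => rw [List.take_succ_cons, List.take_succ_cons, List.map_cons, List.map_cons,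
        List.sum_cons, List.sum_cons, ih, List.getD_cons_succ, add_assoc]

theorem odd_add_sum {A : ℤ} (hA : Odd A) {l : List (ℤ × ℕ)} (hl : ∀ x ∈ l, IsTailDatum x) :
    Odd (A + (l.map Prod.fst).sum) := by
  refine hA.add_even ?_
  induction l with
  | nil => simp
  | cons x l ih =>
    rw [List.map_cons, List.sum_cons]
    exact (hl x (by simp)).2.1.add (ih fun y hy => hl y (by simp [hy]))

theorem getD_mem {α : Type*} {l : List α} {i : ℕ} (d : α) (hi : i < l.length) :
    l.getD i d ∈ l := by
  rw [List.getD_eq_getElem _ _ hi]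
  exact List.getElem_mem hi

/-- The zigzag cover whose path starts with signed weight `A` and meets the given tails. -/
def ofList (A : ℤ) (l : List (ℤ × ℕ)) (hA : Odd A) (hl : ∀ x ∈ l, IsTailDatum x)
    (h2 : 2 ≤ l.length) : ZigzagData where
  n := l.length
  flow j := A + ((l.take j).map Prod.fst).sum
  height i := (l.getD i (0, 0)).2
  two_le := h2
  odd_flow j _ := odd_add_sum hA fun x hx => hl x (List.mem_of_mem_take hx)
  flow_ne i hi := by
    rw [sum_take_succ_getD, ← add_assoc]
    simpa using (hl _ (getD_mem (0, 0) hi)).1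
  odd_half i hi h := by
    rw [sum_take_succ_getD, ← add_assoc, add_sub_cancel_left]
    exact (hl _ (getD_mem (0, 0) hi)).2.2 h

section

variable {A : ℤ} {l : List (ℤ × ℕ)} (hA : Odd A) (hl : ∀ x ∈ l, IsTailDatum x)
  (h2 : 2 ≤ l.length)

theorem ofList_tailFlow (i : ℕ) : (ofList A l hA hl h2).tailFlow i = (l.getD i (0, 0)).1 := by
  simp only [tailFlow, ofList]
  rw [sum_take_succ_getD, ← add_assoc, add_sub_cancel_left]

theorem ofList_tailEnds (i : ℕ) : (ofList A l hA hl h2).tailEnds i = ends (l.getD i (0, 0)) := by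
  simp only [tailEnds, tailWeight, ofList_tailFlow]
  rfl

theorem ofList_flow_zero : (ofList A l hA hl h2).flow 0 = A := by simp [ofList]

theorem ofList_flow_n :
    (ofList A l hA hl h2).flow (ofList A l hA hl h2).n = A + (l.map Prod.fst).sum := by
  simp only [ofList, List.take_length]

theorem ofList_leftEnds {B : ℤ} (hB : A + (l.map Prod.fst).sum = B) :
    (ofList A l hA hl h2).leftEnds =
      (if 0 < A then {A.natAbs} else 0) + (if B < 0 then {B.natAbs} else 0) + lowerEnds l := by
  rw [leftEnds, ofList_flow_n, ofList_flow_zero, hB, lowerEnds, ← sum_range_getD l (0, 0)]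
  simp only [ofList_tailFlow, ofList_tailEnds]
  rfl

theorem ofList_rightEnds {B : ℤ} (hB : A + (l.map Prod.fst).sum = B) :
    (ofList A l hA hl h2).rightEnds =
      (if A < 0 then {A.natAbs} else 0) + (if 0 < B then {B.natAbs} else 0) + upperEnds l := by
  rw [rightEnds, ofList_flow_n, ofList_flow_zero, hB, upperEnds, ← sum_range_getD l (0, 0)]
  simp only [ofList_tailFlow, ofList_tailEnds]
  rfl

theorem ofList_sum_height : ∑ i ∈ Finset.range (ofList A l hA hl h2).n,
    (ofList A l hA hl h2).height i / 2 = (l.map fun x => x.2 / 2).sum := by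
  rw [← sum_range_getD l (0, 0)]
  rfl

end

@[simp] theorem lowerEnds_append (l l' : List (ℤ × ℕ)) :
    lowerEnds (l ++ l') = lowerEnds l + lowerEnds l' := by simp [lowerEnds]

@[simp] theorem upperEnds_append (l l' : List (ℤ × ℕ)) :
    upperEnds (l ++ l') = upperEnds l + upperEnds l' := by simp [upperEnds]

theorem ends_two {h : ℕ} (hh : Odd h) : ends (2, h) = Multiset.replicate 2 1 := by
  obtain ⟨k, rfl⟩ := hh
  have : (2 * k + 1) % 2 = 1 := by omega
  simp [ends, this]

theorem ends_neg_two {h : ℕ} (hh : Odd h) : ends (-2, h) = Multiset.replicate 2 1 := by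
  obtain ⟨k, rfl⟩ := hh
  have : (2 * k + 1) % 2 = 1 := by omega
  simp [ends, this]

theorem lowerEnds_left_forks (k : ℕ) :
    lowerEnds (List.replicate k (2, 1)) = Multiset.replicate (2 * k) 1 := by
  simpa [lowerEnds, ends_two, mul_comm] using Multiset.nsmul_replicate k 2

theorem upperEnds_left_forks (k : ℕ) : upperEnds (List.replicate k (2, 1)) = 0 := by
  simp [upperEnds]

theorem lowerEnds_right_forks (k : ℕ) : lowerEnds (List.replicate k (-2, 1)) = 0 := by
  simp [lowerEnds]

theorem upperEnds_right_forks (k : ℕ) :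
    upperEnds (List.replicate k (-2, 1)) = Multiset.replicate (2 * k) 1 := by
  simpa [upperEnds, ends_neg_two, mul_comm] using Multiset.nsmul_replicate k 2

/-- Left tails of heights `h 0, …, h (M - 1)` alternating with right forks. -/
def zigzagList (h : ℕ → ℕ) (M : ℕ) : List (ℤ × ℕ) :=
  (List.range (2 * M)).map fun j => if j % 2 = 0 then (2, h (j / 2)) else (-2, 1)

theorem sum_map_zigzagList {N : Type*} [AddCommMonoid N] (h : ℕ → ℕ) (M : ℕ) (f : ℤ × ℕ → N) :
    ((zigzagList h M).map f).sum = ∑ i ∈ Finset.range M, (f (2, h i) + f (-2, 1)) := by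
  unfold zigzagList
  induction M with
  | zero => simp
  | succ M ih =>
    rw [show 2 * (M + 1) = 2 * M + 1 + 1 by ring, List.range_succ, List.range_succ,
      Finset.sum_range_succ, ← ih]
    have h1 : (2 * M + 1) % 2 = 1 := by omega
    simp [h1]

theorem isTailDatum_fork (h : ℕ) : IsTailDatum (2, h) :=
  ⟨by norm_num, even_two, fun _ => ⟨0, by norm_num⟩⟩

theorem isTailDatum_neg_fork (h : ℕ) : IsTailDatum (-2, h) :=
  ⟨by norm_num, even_neg.2 even_two, fun _ => ⟨-1, by norm_num⟩⟩

theorem isTailDatum_zigzagList (h : ℕ → ℕ) (M : ℕ) : ∀ x ∈ zigzagList h M, IsTailDatum x := by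
  intro x hx
  obtain ⟨j, -, rfl⟩ := List.mem_map.1 hx
  split_ifs
  · exact isTailDatum_fork _
  · exact isTailDatum_neg_fork _

theorem lowerEnds_zigzagList {h : ℕ → ℕ} (hh : ∀ i, Odd (h i)) (M : ℕ) :
    lowerEnds (zigzagList h M) = Multiset.replicate (2 * M) 1 := by
  rw [lowerEnds, sum_map_zigzagList]
  simpa [ends_two, hh, mul_comm] using Multiset.nsmul_replicate M 2

theorem upperEnds_zigzagList (h : ℕ → ℕ) (M : ℕ) :
    upperEnds (zigzagList h M) = Multiset.replicate (2 * M) 1 := by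
  rw [upperEnds, sum_map_zigzagList]
  simpa [ends_neg_two, mul_comm] using Multiset.nsmul_replicate M 2

theorem length_zigzagList (h : ℕ → ℕ) (M : ℕ) : (zigzagList h M).length = 2 * M := by
  simp [zigzagList]

theorem take_zigzagList (h : ℕ → ℕ) {i M : ℕ} (hi : i ≤ M) :
    (zigzagList h M).take (2 * i) = zigzagList h i := by
  rw [zigzagList, ← List.map_take, List.take_range, min_eq_left (by omega)]
  rfl

theorem getD_zigzagList (h : ℕ → ℕ) {j M : ℕ} (hj : j < 2 * M) (d : ℤ × ℕ) :
    (zigzagList h M).getD j d = if j % 2 = 0 then (2, h (j / 2)) else (-2, 1) := by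
  rw [List.getD_eq_getElem _ _ (by rwa [length_zigzagList])]
  simp [zigzagList]

/-- The tails in `l₁` bring the path weight to -1; afterwards 2 and -2 are added alternately. A
non-empty `l₁` makes the zigzag start at a positive index, as `rigid` requires. -/
theorem hasZigzag_ofList {A : ℤ} {l₁ l₂ : List (ℤ × ℕ)} {h : ℕ → ℕ} {M : ℕ} (hA : Odd A)
    (hl : ∀ x ∈ l₁ ++ (zigzagList h M ++ l₂), IsTailDatum x)
    (h2 : 2 ≤ (l₁ ++ (zigzagList h M ++ l₂)).length) (h1 : l₁ ≠ [])
    (hsum : A + (l₁.map Prod.fst).sum = -1) :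
    (ofList A _ hA hl h2).HasZigzag l₁.length M ∧
      (∀ i < M, (ofList A _ hA hl h2).height (l₁.length + 2 * i) = h i) ∧
      ∀ i < M, (ofList A _ hA hl h2).height (l₁.length + 2 * i + 1) = 1 := by
  have hget (j : ℕ) (hj : j < 2 * M) :
      (l₁ ++ (zigzagList h M ++ l₂)).getD (l₁.length + j) (0, 0) =
        if j % 2 = 0 then (2, h (j / 2)) else (-2, 1) := by
    rw [List.getD_append_right _ _ _ _ (by omega), Nat.add_sub_cancel_left,
      List.getD_append _ _ _ _ (by rwa [length_zigzagList]), getD_zigzagList h hj]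
  have heven (i : ℕ) (hi : i ≤ M) : (ofList A _ hA hl h2).flow (l₁.length + 2 * i) = -1 := by
    simp only [ofList]
    rw [List.take_length_add_append, List.take_append_of_le_length
      (by rw [length_zigzagList]; omega), take_zigzagList h hi, List.map_append, List.sum_append,
      sum_map_zigzagList, ← add_assoc, hsum]
    simp
  refine ⟨⟨List.length_pos_iff.2 h1, ?_, heven, ?_⟩, ?_, ?_⟩
  · simp only [ofList, List.length_append, length_zigzagList]
    omega
  · intro i hi
    have h3 : (ofList A _ hA hl h2).tailFlow (l₁.length + 2 * i) = 2 := by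
      rw [ofList_tailFlow, hget _ (by omega), if_pos (by omega)]
    rw [tailFlow, heven i hi.le] at h3
    linarith
  · intro i hi
    simp only [ofList]
    rw [hget _ (by omega), if_pos (by omega), Nat.mul_div_cancel_left _ two_pos]
  · intro i hi
    simp only [ofList]
    rw [add_assoc, hget _ (by omega), if_neg (by omega)]

theorem mem_numOddOdd_filter (s : Multiset ℕ) (k : ℕ) :
    k ∈ s.toFinset.filter (fun k => Odd k ∧ Odd (s.count k)) ↔ Odd k ∧ Odd (s.count k) := by
  rw [Finset.mem_filter, Multiset.mem_toFinset, and_iff_right_iff_imp]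
  rintro ⟨-, h⟩
  exact Multiset.count_pos.1 h.pos

/-- Any collection of ends is divided into ends of even weight, symmetric forks of odd weight, and
distinct single ends of odd weight. -/
theorem exists_tails (σ : ℤ) (hσ : σ = 1 ∨ σ = -1) (s : Multiset ℕ) (hs : ∀ a ∈ s, 0 < a) :
    ∃ (X : List (ℤ × ℕ)) (O : Multiset ℕ), (∀ x ∈ X, IsTailDatum x ∧ x.2 / 2 = 0 ∧ 0 < σ * x.1) ∧
      (∀ a ∈ O, Odd a) ∧ O.Nodup ∧ Multiset.card O = numOddOdd s ∧ s = O + (X.map ends).sum ∧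
      (s.sum : ℤ) = O.sum + σ * (X.map Prod.fst).sum := by
  have hσ2 : σ * σ = 1 := by rcases hσ with rfl | rfl <;> rfl
  have hnat (a : ℤ) : (σ * a).natAbs = a.natAbs := by rcases hσ with rfl | rfl <;> simp
  induction hn : Multiset.card s using Nat.strong_induction_on generalizing s with
  | _ n ih =>
  by_cases he : ∃ a ∈ s, Even a
  · obtain ⟨a, ha, hae⟩ := he
    obtain ⟨s, rfl⟩ := Multiset.exists_cons_of_mem ha
    obtain ⟨X, O, h1, h2, h3, h4, h5, h6⟩ := ih (Multiset.card s) (by simp at hn; omega) s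
      (fun b hb => hs b (Multiset.mem_cons_of_mem hb)) rfl
    have ha0 := hs a ha
    -- An end of even weight is a tail of height 0.
    refine ⟨(σ * a, 0) :: X, O, ?_, h2, h3, ?_, ?_, ?_⟩
    · intro x hx
      rcases List.mem_cons.1 hx with rfl | hx
      · refine ⟨⟨?_, ?_, by simp⟩, by simp, ?_⟩
        · simp only; rcases hσ with rfl | rfl <;> simp <;> omega
        · exact ((Int.even_coe_nat a).2 hae).mul_left σ
        · simp only
          rw [← mul_assoc, hσ2]
          omega
      · exact h1 x hx
    · rw [h4]
      refine congrArg Finset.card (Finset.ext fun k => ?_)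
      rw [mem_numOddOdd_filter, mem_numOddOdd_filter]
      refine and_congr_right fun hk => ?_
      have hka : k ≠ a := by
        rintro rfl
        exact (Nat.not_even_iff_odd.2 hk) hae
      rw [Multiset.count_cons_of_ne hka]
    · have : ends (σ * a, 0) = {a} := by simp [ends, hnat]
      rw [List.map_cons, List.sum_cons, this, ← add_assoc, add_comm O, add_assoc, ← h5,
        Multiset.singleton_add]
    · rw [Multiset.sum_cons, List.map_cons, List.sum_cons, mul_add, ← mul_assoc, hσ2]
      simp only [Nat.cast_add, one_mul]
      linarith
  by_cases hc : ∃ a, 2 ≤ s.count a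
  · obtain ⟨a, ha2⟩ := hc
    have ha : a ∈ s := Multiset.count_pos.1 (by omega)
    obtain ⟨s, rfl⟩ := Multiset.exists_cons_of_mem ha
    rw [Multiset.count_cons_self] at ha2
    obtain ⟨s, rfl⟩ := Multiset.exists_cons_of_mem (Multiset.count_pos.1 (by omega : 0 < s.count a))
    obtain ⟨X, O, h1, h2, h3, h4, h5, h6⟩ := ih (Multiset.card s) (by simp at hn; omega) s
      (fun b hb => hs b (Multiset.mem_cons_of_mem (Multiset.mem_cons_of_mem hb))) rfl
    have ha0 := hs a ha
    -- Two equal ends form a fork, that is, a tail of height 1 whose stem has twice their weight;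
    -- removing both keeps the parity of every multiplicity.
    refine ⟨(σ * (2 * a), 1) :: X, O, ?_, h2, h3, ?_, ?_, ?_⟩
    · intro x hx
      rcases List.mem_cons.1 hx with rfl | hx
      · refine ⟨⟨?_, ?_, by simp⟩, by simp, ?_⟩
        · simp only; rcases hσ with rfl | rfl <;> simp <;> omega
        · exact (even_two_mul (a : ℤ)).mul_left σ
        · simp only
          rw [← mul_assoc, hσ2]
          omega
      · exact h1 x hx
    · rw [h4]
      refine congrArg Finset.card (Finset.ext fun k => ?_)
      rw [mem_numOddOdd_filter, mem_numOddOdd_filter]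
      refine and_congr_right fun hk => ?_
      rw [Multiset.count_cons, Multiset.count_cons]
      split_ifs
      · rw [Nat.odd_iff, Nat.odd_iff]
        omega
      · rfl
    · have : ends (σ * (2 * a), 1) = {a, a} := by
        have h7 : (σ * (2 * (a : ℤ)) / 2).natAbs = a := by
          rcases hσ with rfl | rfl <;> omega
        simp only [ends]
        rw [if_neg (by norm_num), h7]
        rfl
      rw [List.map_cons, List.sum_cons, this, ← add_assoc, add_comm O, add_assoc, ← h5]
      simp [Multiset.insert_eq_cons]
    · rw [Multiset.sum_cons, Multiset.sum_cons, List.map_cons, List.sum_cons, mul_add, ← mul_assoc,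
        hσ2]
      simp only [Nat.cast_add, one_mul]
      linarith
  · push Not at he hc
    have hnd : s.Nodup := Multiset.nodup_iff_count_le_one.2 fun a => Nat.le_of_lt_succ (hc a)
    refine ⟨[], s, by simp, fun a ha => Nat.not_even_iff_odd.1 (he a ha), hnd, ?_, by simp,
      by simp⟩
    rw [← Multiset.toFinset_card_of_nodup hnd]
    refine congrArg Finset.card (Finset.ext fun k => ?_)
    rw [mem_numOddOdd_filter, Multiset.mem_toFinset]
    refine ⟨fun h => ⟨Nat.not_even_iff_odd.1 (he k h), ?_⟩, fun h => Multiset.count_pos.1 h.2.pos⟩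
    rw [Multiset.count_eq_one_of_mem hnd h]
    exact odd_one

/-- The signed weights of the two ends of the path. If there are no single ends of odd weight, two
of the additional lower ends of weight one are used. -/
theorem exists_path_ends (O₁ O₂ : Multiset ℕ) (h₁ : ∀ a ∈ O₁, Odd a) (h₂ : ∀ a ∈ O₂, Odd a)
    (hcard : Multiset.card O₁ + Multiset.card O₂ = 0 ∨ Multiset.card O₁ + Multiset.card O₂ = 2) :
    ∃ (A B : ℤ) (e : ℕ), Odd A ∧
      (if 0 < A then {A.natAbs} else 0) + (if B < 0 then {B.natAbs} else 0) =
        O₁ + Multiset.replicate (2 * e) 1 ∧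
      (if A < 0 then {A.natAbs} else 0) + (if 0 < B then {B.natAbs} else 0) = O₂ ∧
      A - B = O₁.sum + 2 * e - O₂.sum := by
  rcases hcard with h | h
  · obtain rfl : O₁ = 0 := Multiset.card_eq_zero.1 (by omega)
    obtain rfl : O₂ = 0 := Multiset.card_eq_zero.1 (by omega)
    -- Here both ends of the path go to -∞ with weight 1, which uses up one extra pair of lower
    -- ends.
    exact ⟨1, -1, 1, by decide, by simp, by simp, by norm_num⟩
  obtain h | h | h : Multiset.card O₁ = 0 ∨ Multiset.card O₁ = 1 ∨ Multiset.card O₁ = 2 := by omega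
  · obtain rfl := Multiset.card_eq_zero.1 h
    obtain ⟨a, b, rfl⟩ := Multiset.card_eq_two.1 (by omega : Multiset.card O₂ = 2)
    have ha := h₂ a (by simp)
    have hb := h₂ b (by simp)
    refine ⟨-a, b, 0, by simpa using ha, ?_, ?_, by simp; ring⟩
    · simp
    · simp [ha.pos, hb.pos]
  · obtain ⟨a, rfl⟩ := Multiset.card_eq_one.1 h
    obtain ⟨b, rfl⟩ := Multiset.card_eq_one.1 (by omega : Multiset.card O₂ = 1)
    have ha := h₁ a (by simp)
    have hb := h₂ b (by simp)
    refine ⟨a, b, 0, by simpa using ha, ?_, ?_, by simp⟩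
    · simp [ha.pos, show ¬ ((b : ℤ) < 0) by omega]
    · simp [hb.pos, show ¬ ((a : ℤ) < 0) by omega]
  · obtain rfl := Multiset.card_eq_zero.1 (by omega : Multiset.card O₂ = 0)
    obtain ⟨a, b, rfl⟩ := Multiset.card_eq_two.1 h
    have ha := h₁ a (by simp)
    have hb := h₁ b (by simp)
    refine ⟨a, -b, 0, by simpa using ha, ?_, ?_, by simp⟩
    · simp [ha.pos, hb.pos]
    · simp

theorem sum_mod_two (O : Multiset ℕ) (h : ∀ a ∈ O, Odd a) : O.sum % 2 = Multiset.card O % 2 := by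
  induction O using Multiset.induction with
  | empty => rfl
  | cons a O ih =>
    have h1 := Nat.odd_iff.1 (h a (by simp))
    have h2 := ih fun b hb => h b (by simp [hb])
    rw [Multiset.sum_cons, Multiset.card_cons]
    omega

theorem even_sum_fst (l : List (ℤ × ℕ)) (hl : ∀ x ∈ l, IsTailDatum x) :
    Even (l.map Prod.fst).sum := by
  have := odd_add_sum odd_one hl
  rw [Int.odd_add] at this
  exact this.1 odd_one

/-- All tails outside the zigzag have height at most 1 and carry no genus. They depend only on λ and
μ, hence so does K; the genus sits in the freely chosen heights `h`. -/
theorem exists_hasZigzag (lam mu : Multiset ℕ) (hlam : ∀ a ∈ lam, 0 < a) (hmu : ∀ a ∈ mu, 0 < a)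
    (hsum : lam.sum = mu.sum) (hodd : numOddOdd lam + numOddOdd mu ≤ 2) :
    ∃ a K : ℕ, ∀ (M : ℕ) (h : ℕ → ℕ), 0 < M → (∀ i, Odd (h i)) → ∃ D : ZigzagData,
      D.HasZigzag a M ∧ (∀ i < M, D.height (a + 2 * i) = h i) ∧
      (∀ i < M, D.height (a + 2 * i + 1) = 1) ∧
      D.leftEnds = lam + Multiset.replicate (2 * (M + K)) 1 ∧
      D.rightEnds = mu + Multiset.replicate (2 * (M + K)) 1 ∧
      ∑ i ∈ Finset.range D.n, D.height i / 2 = ∑ i ∈ Finset.range M, h i / 2 := by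
  obtain ⟨X, O, hX, hO, -, hOc, hlamX, hlamS⟩ := exists_tails 1 (Or.inl rfl) lam hlam
  obtain ⟨Y, P, hY, hP, -, hPc, hmuY, hmuS⟩ := exists_tails (-1) (Or.inr rfl) mu hmu
  have hXe := even_sum_fst X fun x hx => (hX x hx).1
  have hYe := even_sum_fst Y fun x hx => (hY x hx).1
  -- The sums of `O` and `P` have equal parity, as λ and μ have equal sums and tails have even
  -- weight; this rules out a single odd end.
  have hcard : Multiset.card O + Multiset.card P = 0 ∨ Multiset.card O + Multiset.card P = 2 := by
    have h1 := sum_mod_two O hO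
    have h2 := sum_mod_two P hP
    obtain ⟨x, hx⟩ := hXe
    obtain ⟨y, hy⟩ := hYe
    omega
  obtain ⟨A, B, e, hA, hleft, hright, hAB⟩ := exists_path_ends O P hO hP hcard
  set F := A + (X.map Prod.fst).sum + (Y.map Prod.fst).sum with hF
  have hFodd : Odd F := (hA.add_even hXe).add_even hYe
  -- The numbers of left and right forks that bring the path weight from `F` to -1; `0 < p` keeps
  -- `l₁` non-empty.
  obtain ⟨p, q, hp, hpq⟩ : ∃ p q : ℕ, 0 < p ∧ F + 2 * p - 2 * q = -1 := by
    obtain ⟨k, hk⟩ := hFodd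
    exact ⟨k.natAbs + 1, (k.natAbs + 1 + (k + 1)).toNat, by omega, by omega⟩
  set l₁ : List (ℤ × ℕ) := X ++ (Y ++ (List.replicate p (2, 1) ++ List.replicate q (-2, 1)))
    with hl₁
  -- After the zigzag the fork numbers are swapped, with `e` more on the right to offset the lower
  -- ends used by the path. Each side then uses e + p + q pairs of ends of weight 1 besides those of
  -- the zigzag.
  set l₂ : List (ℤ × ℕ) := List.replicate q (2, 1) ++ List.replicate (e + p) (-2, 1) with hl₂
  refine ⟨l₁.length, e + p + q, fun M h hM hh => ?_⟩
  have hXl : lowerEnds X = (X.map ends).sum ∧ upperEnds X = 0 := by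
    constructor
    · refine congrArg List.sum (List.map_congr_left fun x hx => ?_)
      have := (hX x hx).2.2
      rw [if_pos (by linarith)]
    · refine List.sum_eq_zero fun y hy => ?_
      obtain ⟨x, hx, rfl⟩ := List.mem_map.1 hy
      have := (hX x hx).2.2
      rw [if_neg (by linarith)]
  have hYl : lowerEnds Y = 0 ∧ upperEnds Y = (Y.map ends).sum := by
    constructor
    · refine List.sum_eq_zero fun y hy => ?_
      obtain ⟨x, hx, rfl⟩ := List.mem_map.1 hy
      have := (hY x hx).2.2
      rw [if_neg (by linarith)]
    · refine congrArg List.sum (List.map_congr_left fun x hx => ?_)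
      have := (hY x hx).2.2
      rw [if_pos (by linarith)]
  have hl : ∀ x ∈ l₁ ++ (zigzagList h M ++ l₂), IsTailDatum x := by
    intro x hx
    simp only [hl₁, hl₂, List.mem_append, List.mem_replicate] at hx
    rcases hx with (hx | hx | ⟨-, rfl⟩ | ⟨-, rfl⟩) | hx | ⟨-, rfl⟩ | ⟨-, rfl⟩
    · exact (hX x hx).1
    · exact (hY x hx).1
    · exact isTailDatum_fork _
    · exact isTailDatum_neg_fork _
    · exact isTailDatum_zigzagList h M x hx
    · exact isTailDatum_fork _
    · exact isTailDatum_neg_fork _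
  have h2 : 2 ≤ (l₁ ++ (zigzagList h M ++ l₂)).length := by
    simp only [List.length_append, length_zigzagList]
    omega
  have hne : l₁ ≠ [] := by
    rw [hl₁, ← List.length_pos_iff]
    simp only [List.length_append, List.length_replicate]
    omega
  have hs₁ : A + (l₁.map Prod.fst).sum = -1 := by
    simp only [hl₁, List.map_append, List.sum_append, List.map_replicate, List.sum_replicate,
      nsmul_eq_mul]
    linarith
  have hB : A + ((l₁ ++ (zigzagList h M ++ l₂)).map Prod.fst).sum = B := by
    rw [List.map_append, List.sum_append, ← add_assoc, hs₁, List.map_append, List.sum_append,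
      sum_map_zigzagList]
    simp only [hl₂, List.map_append, List.sum_append, List.map_replicate, List.sum_replicate,
      nsmul_eq_mul]
    have hsum' : (lam.sum : ℤ) = mu.sum := by exact_mod_cast hsum
    push_cast
    simp only [Finset.sum_const_zero]
    linarith
  obtain ⟨hz, hz1, hz2⟩ := hasZigzag_ofList hA hl h2 hne hs₁
  refine ⟨_, hz, hz1, hz2, ?_, ?_, ?_⟩
  · rw [ofList_leftEnds hA hl h2 hB, hleft]
    simp only [hl₁, hl₂, lowerEnds_append, lowerEnds_left_forks, lowerEnds_right_forks,
      lowerEnds_zigzagList hh, hXl.1, hYl.1]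
    conv_rhs => rw [hlamX]
    rw [show 2 * (M + (e + p + q)) = 2 * e + (2 * p + (2 * M + 2 * q)) by ring,
      Multiset.replicate_add, Multiset.replicate_add, Multiset.replicate_add]
    abel
  · rw [ofList_rightEnds hA hl h2 hB, hright]
    simp only [hl₁, hl₂, upperEnds_append, upperEnds_left_forks, upperEnds_right_forks,
      upperEnds_zigzagList, hXl.2, hYl.2]
    conv_rhs => rw [hmuY]
    rw [show 2 * (M + (e + p + q)) = 2 * q + (2 * M + 2 * (e + p)) by ring,
      Multiset.replicate_add, Multiset.replicate_add]
    abel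
  · rw [ofList_sum_height]
    have hX0 : (X.map fun x => x.2 / 2).sum = 0 := List.sum_eq_zero fun y hy => by
      obtain ⟨x, hx, rfl⟩ := List.mem_map.1 hy
      exact (hX x hx).2.1
    have hY0 : (Y.map fun x => x.2 / 2).sum = 0 := List.sum_eq_zero fun y hy => by
      obtain ⟨x, hx, rfl⟩ := List.mem_map.1 hy
      exact (hY x hx).2.1
    simp [hl₁, hl₂, hX0, hY0, sum_map_zigzagList]

end ZigzagData

end

/-! ### Asymptotics -/

open scoped Nat in
-- From M^n / n! ≤ e^M. Having ln M rather than ln n lets the incomplete positions, with n = s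
-- possibly much smaller than M, count at the full rate.
theorem mul_log_sub_le_log_factorial (n : ℕ) {M : ℕ} (hM : 0 < M) :
    n * Real.log M - M ≤ Real.log (n ! : ℝ) := by
  have hM' : (0 : ℝ) < M := Nat.cast_pos.2 hM
  have hn : (0 : ℝ) < n ! := Nat.cast_pos.2 (Nat.factorial_pos n)
  have h := Real.log_le_log (by positivity) (Real.pow_div_factorial_le_exp (M : ℝ) hM'.le n)
  rw [Real.log_exp, Real.log_div (by positivity) hn.ne', Real.log_pow] at h
  linarith

/-- The lower bound on zigzag numbers before taking the limit. -/
theorem exists_le_log_zigzagNumber {lam mu : Multiset ℕ} (hlam : ∀ a ∈ lam, 0 < a)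
    (hmu : ∀ a ∈ mu, 0 < a) (hsum : lam.sum = mu.sum)
    (hodd : numOddOdd lam + numOddOdd mu ≤ 2) :
    ∃ K : ℕ, ∀ g m : ℕ, K < m →
      ∀ z : Fin (lam.card + mu.card + 2 * g + 4 * m - 2) → ℝ, StrictMono z →
      (2 * g + 4 * (m - K : ℝ)) * (Real.log (m - K) - 2) ≤
        Real.log (zigzagNumber g (lam + Multiset.replicate (2 * m) 1)
          (mu + Multiset.replicate (2 * m) 1) z) := by
  obtain ⟨a, K, hK⟩ := ZigzagData.exists_hasZigzag lam mu hlam hmu hsum hodd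
  refine ⟨K, fun g m hm z hz => ?_⟩
  obtain ⟨M, rfl⟩ : ∃ M, m = M + K := ⟨m - K, by omega⟩
  have hM : 0 < M := by omega
  -- The genus is spread evenly over the left tails: q cycles on each, and one more on s of them.
  have hgs : M * (g / M) + g % M = g := Nat.div_add_mod g M
  have hs : g % M ≤ M := (Nat.mod_lt g hM).le
  generalize g / M = q at hgs
  generalize g % M = s at hgs hs
  obtain ⟨D, hz', hh, hh1, hleft, hright, hgen⟩ :=
    hK M (fun i => 2 * (q + if i < s then 1 else 0) + 1) hM fun i => odd_two_mul_add_one _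
  have hgen' : ∑ i ∈ Finset.range D.n, D.height i / 2 = g := by
    have h1 (i : ℕ) : (2 * (q + if i < s then 1 else 0) + 1) / 2 = q + if i < s then 1 else 0 := by
      omega
    simp only [h1] at hgen
    rw [hgen, Finset.sum_add_distrib, ← Finset.sum_filter, Finset.sum_const, Finset.sum_const,
      Finset.card_range, show (Finset.range M).filter (fun i => i < s) = Finset.range s from by
        ext i; simp; omega, Finset.card_range]
    simpa using hgs
  have hcard := D.card_inner_add_two
  rw [hgen', hleft, hright, Multiset.card_add, Multiset.card_add, Multiset.card_replicate] at hcard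
  have key := hz'.factorial_le_zigzagNumber (q := q) (s := s) hz (by omega) hgen' hleft hright hs
    (fun i hi => by rw [hh i hi]; omega) (fun i hi => by rw [hh i (by omega), if_pos hi]; omega)
    (fun i hi => (hh1 i hi).ge)
  have hlog := Real.log_le_log (by positivity) (Nat.cast_le (α := ℝ).2 key)
  refine le_trans ?_ hlog
  push_cast
  rw [Real.log_mul (by positivity) (by positivity), Real.log_pow, Real.log_pow, add_sub_cancel_right]
  have h1 := mul_log_sub_le_log_factorial M hM
  have h2 := mul_log_sub_le_log_factorial s hM
  have hg : (g : ℝ) = M * q + s := by exact_mod_cast hgs.symm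
  have hM0 : (0 : ℝ) ≤ M := Nat.cast_nonneg M
  have hq0 : (0 : ℝ) ≤ q := Nat.cast_nonneg q
  have hs0 : (0 : ℝ) ≤ s := Nat.cast_nonneg s
  -- Since 2g + 4M = (2q + 4)M + 2s, the logarithmic terms agree; the total error (2q + 4)M + 2M is
  -- at most twice (2q + 4)M + 2s.
  calc (2 * (g : ℝ) + 4 * M) * (Real.log M - 2)
      ≤ (2 * q + 4) * (M * Real.log M - M) + 2 * (s * Real.log M - M) := by
        rw [hg]; nlinarith [mul_nonneg hM0 hq0]
    _ ≤ _ := by push_cast; gcongr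

theorem theorem1p2 {d : ℕ} (lam mu : Nat.Partition d)
    (hodd : numOddOdd lam.parts + numOddOdd mu.parts ≤ 2)
    (z : ∀ g m : ℕ, Fin (lam.parts.card + mu.parts.card + 2 * g + 4 * m - 2) → ℝ)
    (hz : ∀ g m : ℕ, StrictMono (z g m)) :
    (1 : EReal) ≤ liminf (fun p : ℕ × ℕ =>
      ((Real.log (zigzagNumber p.1 (lam.parts + Multiset.replicate (2 * p.2) 1)
            (mu.parts + Multiset.replicate (2 * p.2) 1) (z p.1 p.2)) /
          (2 * p.1 * Real.log p.2 + 4 * p.2 * Real.log p.2) : ℝ) : EReal))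
      (atTop ×ˢ atTop) := by
  obtain ⟨K, hK⟩ := exists_le_log_zigzagNumber (fun a ha => lam.parts_pos ha)
    (fun a ha => mu.parts_pos ha) (lam.parts_sum.trans mu.parts_sum.symm) hodd
  have hlog : Tendsto (fun m : ℕ => Real.log m) atTop atTop :=
    Real.tendsto_log_atTop.comp tendsto_natCast_atTop_atTop
  -- A lower bound for the quotient that does not involve g, so that g and m may tend to infinity
  -- independently.
  have hlim : Tendsto (fun m : ℕ => (1 - K / (m : ℝ)) * (1 - 3 / Real.log m)) atTop (nhds 1) := by
    have h1 := (tendsto_const_div_atTop_nhds_zero_nat (K : ℝ)).const_sub 1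
    have h2 := (hlog.const_div_atTop 3).const_sub 1
    simpa using h1.mul h2
  have hlim' : Tendsto (fun p : ℕ × ℕ =>
      (((1 - K / (p.2 : ℝ)) * (1 - 3 / Real.log p.2) : ℝ) : EReal)) (atTop ×ˢ atTop) (nhds 1) :=
    (continuous_coe_real_ereal.tendsto _).comp (hlim.comp tendsto_snd)
  rw [← hlim'.liminf_eq]
  refine liminf_le_liminf ?_
  have hev : ∀ᶠ m : ℕ in atTop, 3 ≤ Real.log m ∧ 2 * K + 1 ≤ m :=
    (hlog.eventually_ge_atTop 3).and (eventually_ge_atTop _)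
  filter_upwards [tendsto_snd.eventually hev] with ⟨g, m⟩ ⟨hm3, hmK⟩
  simp only at hm3 hmK ⊢
  rw [EReal.coe_le_coe_iff]
  have hm0 : (0 : ℝ) < m := Nat.cast_pos.2 (by omega)
  have hg0 : (0 : ℝ) ≤ g := Nat.cast_nonneg g
  have hK0 : (0 : ℝ) ≤ K := Nat.cast_nonneg K
  have hmK' : 2 * (K : ℝ) + 1 ≤ m := by exact_mod_cast hmK
  -- Here m - K ≥ m/2 and ln 2 < 1. Together with the 2 in `exists_le_log_zigzagNumber` this loss
  -- makes up the 3 in the comparison function.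
  have hlog2 : Real.log m - 1 ≤ Real.log (m - K) := by
    have h1 : Real.log (m / 2) ≤ Real.log (m - K) :=
      Real.log_le_log (by positivity) (by linarith)
    rw [Real.log_div hm0.ne' two_ne_zero] at h1
    have := Real.log_two_lt_d9
    linarith
  have hden : 0 < 2 * (g : ℝ) * Real.log m + 4 * m * Real.log m := by positivity
  rw [le_div_iff₀ hden]
  refine le_trans ?_ (hK g m (by omega) _ (hz g m))
  have hl0 : Real.log m ≠ 0 := by linarith
  have e1 : (1 - K / (m : ℝ)) * (1 - 3 / Real.log m) *
      (2 * (g : ℝ) * Real.log m + 4 * m * Real.log m) =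
      (2 * g * (1 - K / (m : ℝ)) + 4 * (m - K)) * (Real.log m - 3) := by
    field_simp
  rw [e1]
  have h3 : 0 ≤ K / (m : ℝ) := by positivity
  -- In the first factor only the term 2g · K/m is dropped.
  refine mul_le_mul ?_ (by linarith) (by linarith) (by linarith)
  have := mul_nonneg hg0 h3
  linarith
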